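/- **Definitions.** A *weighted graph* $G$ is a finite connected multigraph (loops allowed) with nonempty vertex set $V(G)$, edge set $E(G)$, edge lengths $\ell(e)>0$, and a fixed orientation of the edges, the edge $e$ going from its tail $e^-$ to its head $e^+$. For an integral $1$-chain $\alpha\colon E(G)\to\mathbb Z$ put $(d^*\alpha)(x)=\sum_{e^+=x}\alpha(e)-\sum_{e^-=x}\alpha(e)$ for $x\in V(G)$, and let $H_1(G,\mathbb Z)=\{\alpha : d^*\alpha=0\}$. Let $\Omega(G)$ be the real vector space of harmonic $1$-forms $\omega=\sum_e\omega_e\,de$, i.e. those with $\sum_{e^+=x}\omega_e=\sum_{e^-=x}\omega_e$ for all $x\in V(G)$, and put $\int_\alpha\omega=\sum_e\alpha(e)\,\omega_e\,\ell(e)$. A *tropical curve* is a compact connected metric space $\Gamma$ in which every point $p$ has a neighbourhood isometric to a star with $n_p\ge1$ rays $[0,r_p)$ glued at $0$ (with its path metric), $p$ corresponding to the centre. A *model* of $\Gamma$ is a weighted graph $G$ together with an identification of its geometric realization with $\Gamma$, each edge $e$ being parametrized by arc length on $[0,\ell(e)]$. A model $G'$ of $\Gamma$ *refines* $G$, written $G\le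 G'$, if it arises from $G$ by subdividing the edges inside $\Gamma$, with the induced orientation; then $de\mapsto\sum_{e'\subset e}de'$ defines a map $\Omega(G)\to\Omega(G')$. Let $\Gamma$ be a tropical curve with a given model $G_0$, and let $R(G_0)$ be the set of models of $\Gamma$ that have a common refinement with $G_0$. Put $\Omega(\Gamma)=\varinjlim_{G\in R(G_0)}\Omega(G)$. For $G\in R(G_0)$ and an integral $1$-chain $\alpha$ of $G$, let $\int_\alpha\in\Omega(\Gamma)^*$ be the functional that sends the class of each $\omega\in\Omega(G)$ to $\int_\alpha\omega$. The *Jacobian* is $$J(\Gamma)=\Omega(\Gamma)^*/H_1(\Gamma,\mathbb Z),\qquad H_1(\Gamma,\mathbb Z)=\Big\{\textstyle\int_\alpha : \alpha\in H_1(G_0,\mathbb Z)\Big\}.$$ Let $\mathrm{Div}^0(\Gamma)$ be the group of degree-zero elements of the free abelian group on the points of $\Gamma$, and let $\mathrm{Prin}(\Gamma)$ be the group of Laplacians of continuous piecewise affine functions on $\Gamma$ with integer slopes; the Laplacian of $f$ has at each point $p$ the coefficient minus the sum of the outgoing slopes of $f$ at $p$. The *Picard group* is $\mathrm{Pic}(\Gamma)=\mathrm{Div}^0(\Gamma)/\mathrm{Prin}(\Gamma)$.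 **Theorem (Tropical Abel–Jacobi theorem).** Let $\Gamma$ be a tropical curve with a given model $G_0$. There is a canonical isomorphism of groups $h\colon J(\Gamma)\to\mathrm{Pic}(\Gamma)$. Precisely, there is exactly one group isomorphism $h\colon J(\Gamma)\to\mathrm{Pic}(\Gamma)$ such that $$h\Big(\Big[\textstyle\int_\alpha\Big]\Big)=[d^*\alpha]$$ for every model $G\in R(G_0)$ and every integral $1$-chain $\alpha$ of $G$. -/

import Mathlib

open Set Filter Topology

noncomputable section

namespace TropicalCurves

/-- A weighted graph: a finite connected multigraph, possibly with loops and multiple edges, with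
a nonempty vertex set, positive edge lengths and a fixed orientation of the edges
(`tail e` is `e⁻` and `head e` is `e⁺`). -/
structure WeightedGraph where
  V : Type
  E : Type
  [fintypeV : Fintype V]
  [fintypeE : Fintype E]
  [nonemptyV : Nonempty V]
  len : E → ℝ
  len_pos : ∀ e, 0 < len e
  tail : E → V
  head : E → V
  connected : ∀ x y : V, Relation.ReflTransGen
    (fun a b => ∃ e, (tail e = a ∧ head e = b) ∨ (tail e = b ∧ head e = a)) x y

attribute [instance] WeightedGraph.fintypeV WeightedGraph.fintypeE WeightedGraph.nonemptyV

namespace WeightedGraph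

variable (G : WeightedGraph)

open scoped Classical in
/-- The operator `d* : C₁(G, A) → C₀(G, A)`, where chains are functions on edges resp. vertices:
`(d*α)(x)` is the sum of `α` over the edges with head `x` minus the sum over those with tail `x`. -/
def dStar (A : Type*) [CommRing A] : (G.E → A) →ₗ[A] (G.V → A) where
  toFun α x := (∑ e with G.head e = x, α e) - ∑ e with G.tail e = x, α e
  map_add' α β := by
    funext x
    simp only [Pi.add_apply, Finset.sum_add_distrib]
    ring
  map_smul' c α := by
    funext x
    simp only [Pi.smul_apply, smul_eq_mul, RingHom.id_apply, ← Finset.mul_sum]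
    ring

/-- `H₁(G, ℤ)`, the group of integral `1`-cycles. -/
def integralCycles : AddSubgroup (G.E → ℤ) :=
  (G.dStar ℤ).toAddMonoidHom.ker

open scoped Classical in
/-- `Ω(G)`, the space of harmonic `1`-forms `∑ ω_e de`; a `1`-form is given by its coefficients. -/
def harmonicForms : Submodule ℝ (G.E → ℝ) where
  carrier := {ω | ∀ x : G.V, ∑ e with G.head e = x, ω e = ∑ e with G.tail e = x, ω e}
  add_mem' {a b} ha hb x := by
    simp only [Pi.add_apply, Finset.sum_add_distrib, ha x, hb x]
  zero_mem' x := by simp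
  smul_mem' c a ha x := by
    simp only [Pi.smul_apply, smul_eq_mul, ← Finset.mul_sum, ha x]

/-- The integration functional `∫_α : Ω(G) → ℝ` of an integral `1`-chain `α`, determined by
`∫_{e'} de = ℓ(e)` if `e = e'` and `0` otherwise; additive in `α`. -/
def integral : (G.E → ℤ) →+ Module.Dual ℝ G.harmonicForms where
  toFun α :=
    { toFun := fun ω => ∑ e, (α e : ℝ) * ω.1 e * G.len e
      map_add' := fun ω η => by
        rw [← Finset.sum_add_distrib]
        refine Finset.sum_congr rfl fun e _ => ?_
        simp only [Submodule.coe_add, Pi.add_apply]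
        ring
      map_smul' := fun c ω => by
        rw [RingHom.id_apply, smul_eq_mul, Finset.mul_sum]
        refine Finset.sum_congr rfl fun e _ => ?_
        simp only [Submodule.coe_smul, Pi.smul_apply, smul_eq_mul]
        ring }
  map_zero' := by ext ω; simp
  map_add' α β := by
    ext ω
    simp only [Pi.add_apply, Int.cast_add, LinearMap.coe_mk, AddHom.coe_mk, LinearMap.add_apply]
    rw [← Finset.sum_add_distrib]
    exact Finset.sum_congr rfl fun e _ => by ring

end WeightedGraph

/-- A star-shaped neighbourhood of `p`: an isometry of the star with `valence` rays of length
`radius` (with its path metric) onto a neighbourhood of `p`, with the centre going to `p`. -/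
structure StarChart {Γ : Type*} [MetricSpace Γ] (p : Γ) where
  valence : ℕ
  valence_pos : 1 ≤ valence
  radius : ℝ
  radius_pos : 0 < radius
  ray : Fin valence → ℝ → Γ
  ray_zero : ∀ k, ray k 0 = p
  dist_same : ∀ k, ∀ s ∈ Ico 0 radius, ∀ t ∈ Ico 0 radius, dist (ray k s) (ray k t) = |s - t|
  dist_ne : ∀ k l, k ≠ l → ∀ s ∈ Ico 0 radius, ∀ t ∈ Ico 0 radius,
    dist (ray k s) (ray l t) = s + t
  mem_nhds : (⋃ k, ray k '' Ico 0 radius) ∈ 𝓝 p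

/-- A (compact) tropical curve, i.e. a metric graph: a compact connected metric space in which
every point has a star-shaped neighbourhood. -/
class IsTropicalCurve (Γ : Type*) [MetricSpace Γ] : Prop where
  compact : CompactSpace Γ
  connected : ConnectedSpace Γ
  exists_starChart : ∀ p : Γ, Nonempty (StarChart p)

/-- A model of `Γ`: a weighted graph together with an identification of its geometric realization
with `Γ`. The edge `e` is parametrized by arc length on `[0, ℓ(e)]`, from its tail to its head;
every point of `Γ` is exactly one of: a vertex, an interior point of an edge. Values of `edge e`
outside `[0, ℓ(e)]` play no role. -/
structure Model (Γ : Type*) [MetricSpace Γ] where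
  graph : WeightedGraph
  vertex : graph.V → Γ
  vertex_injective : Function.Injective vertex
  edge : graph.E → ℝ → Γ
  edge_zero : ∀ e, edge e 0 = vertex (graph.tail e)
  edge_len : ∀ e, edge e (graph.len e) = vertex (graph.head e)
  edge_ne_vertex : ∀ e, ∀ t ∈ Ioo 0 (graph.len e), ∀ v, edge e t ≠ vertex v
  edge_injective : ∀ e e', ∀ t ∈ Ioo 0 (graph.len e), ∀ t' ∈ Ioo 0 (graph.len e'),
    edge e t = edge e' t' → e = e' ∧ t = t'
  cover : ∀ p : Γ, (∃ v, vertex v = p) ∨ ∃ e, ∃ t ∈ Ioo 0 (graph.len e), edge e t = p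
  locally_isometric : ∀ e, ∃ ε > 0, ∀ s ∈ Icc 0 (graph.len e), ∀ t ∈ Icc 0 (graph.len e),
    |s - t| < ε → dist (edge e s) (edge e t) = |s - t|

namespace Model

variable {Γ : Type*} [MetricSpace Γ]

/-- `G ≤ G'` means that `G'` refines `G` inside `Γ`: every edge of `G'` is a piece of an edge of
`G`, with the induced orientation. (As both are models of `Γ`, this says that `G'` arises by
subdividing the edges of `G` in a length-preserving fashion.) -/
instance : Preorder (Model Γ) where
  le G G' := ∀ e' : G'.graph.E, ∃ e : G.graph.E, ∃ c : ℝ, 0 ≤ c ∧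
    c + G'.graph.len e' ≤ G.graph.len e ∧
    ∀ t ∈ Icc 0 (G'.graph.len e'), G'.edge e' t = G.edge e (c + t)
  le_refl G e := ⟨e, 0, le_refl _, by simp, fun t _ => by simp⟩
  le_trans G G' G'' h h' e'' := by
    obtain ⟨e', c', hc', hl', hp'⟩ := h' e''
    obtain ⟨e, c, hc, hl, hp⟩ := h e'
    refine ⟨e, c + c', by linarith, by linarith, fun t ht => ?_⟩
    rw [hp' t ht, hp (c' + t) ⟨by linarith [ht.1], by linarith [ht.2]⟩, add_assoc]

variable {G G' : Model Γ}

/-- The edge of `G` that contains a given edge of the refinement `G'`. -/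
def parent (h : G ≤ G') (e' : G'.graph.E) : G.graph.E := (h e').choose

/-- The position at which an edge of the refinement begins in the edge that contains it. -/
def offset (h : G ≤ G') (e' : G'.graph.E) : ℝ := (h e').choose_spec.choose

theorem offset_nonneg (h : G ≤ G') (e' : G'.graph.E) : 0 ≤ offset h e' :=
  (h e').choose_spec.choose_spec.1

theorem offset_add_len_le (h : G ≤ G') (e' : G'.graph.E) :
    offset h e' + G'.graph.len e' ≤ G.graph.len (parent h e') :=
  (h e').choose_spec.choose_spec.2.1

theorem edge_eq (h : G ≤ G') (e' : G'.graph.E) {t : ℝ} (ht : t ∈ Icc 0 (G'.graph.len e')) :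
    G'.edge e' t = G.edge (parent h e') (offset h e' + t) :=
  (h e').choose_spec.choose_spec.2.2 t ht

/-- An interior point of an edge of `G` that is an interior point of an edge of `G'`. -/
theorem parent_eq (h : G ≤ G') {e : G.graph.E} {e' : G'.graph.E} {u t : ℝ}
    (hu : u ∈ Ioo 0 (G.graph.len e)) (ht : t ∈ Ioo 0 (G'.graph.len e'))
    (hut : G.edge e u = G'.edge e' t) : parent h e' = e ∧ offset h e' + t = u := by
  rw [edge_eq h e' (Ioo_subset_Icc_self ht)] at hut
  have h0 := offset_nonneg h e'
  have h1 := offset_add_len_le h e'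
  obtain ⟨h2, h3⟩ := G.edge_injective _ _ u hu (offset h e' + t)
    ⟨by linarith [ht.1], by linarith [ht.2]⟩ hut
  exact ⟨h2.symm, h3.symm⟩

theorem exists_parent_of_not_vertex (h : G ≤ G') {e : G.graph.E} {u : ℝ}
    (hu : u ∈ Ioo 0 (G.graph.len e)) (hv : ∀ v, G.edge e u ≠ G'.vertex v) :
    ∃ e', parent h e' = e ∧ ∃ t ∈ Ioo 0 (G'.graph.len e'), offset h e' + t = u := by
  rcases G'.cover (G.edge e u) with ⟨v, hv'⟩ | ⟨e', t, ht, het⟩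
  · exact absurd hv'.symm (hv v)
  · obtain ⟨h1, h2⟩ := parent_eq h hu ht het.symm
    exact ⟨e', h1, t, ht, h2⟩

theorem exists_incoming (h : G ≤ G') {e : G.graph.E} {s : ℝ} (hs : s ∈ Ioc 0 (G.graph.len e))
    {v' : G'.graph.V} (hv' : G.edge e s = G'.vertex v') :
    ∃ e', parent h e' = e ∧ offset h e' + G'.graph.len e' = s := by
  have ev1 : ∀ᶠ u in 𝓝[<] s, ∀ e', offset h e' + G'.graph.len e' < s →
      offset h e' + G'.graph.len e' < u := by
    rw [Filter.eventually_all]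
    intro e'
    by_cases hlt : offset h e' + G'.graph.len e' < s
    · filter_upwards [Ioo_mem_nhdsLT hlt] with u hu _ using hu.1
    · exact Filter.Eventually.of_forall fun u h' => absurd h' hlt
  have ev2 : ∀ᶠ u in 𝓝[<] s, ∀ v, G.edge e u ≠ G'.vertex v := by
    rw [Filter.eventually_all]
    intro v
    by_cases hex : ∃ u₀ ∈ Ioo 0 s, G.edge e u₀ = G'.vertex v
    · obtain ⟨u₀, hu₀, he₀⟩ := hex
      filter_upwards [Ioo_mem_nhdsLT hu₀.2] with u hu hc
      have := (G.edge_injective e e u ⟨hu₀.1.trans hu.1, hu.2.trans_le hs.2⟩ u₀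
        ⟨hu₀.1, hu₀.2.trans_le hs.2⟩ (hc.trans he₀.symm)).2
      exact absurd this hu.1.ne'
    · filter_upwards [Ioo_mem_nhdsLT hs.1] with u hu hc
      exact hex ⟨u, hu, hc⟩
  obtain ⟨u, h1, h2, hu⟩ := (ev1.and (ev2.and (Ioo_mem_nhdsLT hs.1))).exists
  obtain ⟨e', hp, t, ht, htu⟩ :=
    exists_parent_of_not_vertex h (e := e) ⟨hu.1, hu.2.trans_le hs.2⟩ h2
  refine ⟨e', hp, ?_⟩
  by_contra hne
  have hge : s ≤ offset h e' + G'.graph.len e' := by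
    by_contra hlt
    have := h1 e' (not_le.mp hlt)
    linarith [ht.2]
  have hgt := lt_of_le_of_ne hge (Ne.symm hne)
  have hin : s - offset h e' ∈ Ioo 0 (G'.graph.len e') :=
    ⟨by linarith [ht.1, hu.2], by linarith⟩
  refine G'.edge_ne_vertex e' _ hin v' ?_
  rw [edge_eq h e' (Ioo_subset_Icc_self hin), hp, add_sub_cancel, hv']

theorem exists_outgoing (h : G ≤ G') {e : G.graph.E} {s : ℝ} (hs : s ∈ Ico 0 (G.graph.len e))
    {v' : G'.graph.V} (hv' : G.edge e s = G'.vertex v') :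
    ∃ e', parent h e' = e ∧ offset h e' = s := by
  have ev1 : ∀ᶠ u in 𝓝[>] s, ∀ e', s < offset h e' → u < offset h e' := by
    rw [Filter.eventually_all]
    intro e'
    by_cases hlt : s < offset h e'
    · filter_upwards [Ioo_mem_nhdsGT hlt] with u hu _ using hu.2
    · exact Filter.Eventually.of_forall fun u h' => absurd h' hlt
  have ev2 : ∀ᶠ u in 𝓝[>] s, ∀ v, G.edge e u ≠ G'.vertex v := by
    rw [Filter.eventually_all]
    intro v
    by_cases hex : ∃ u₀ ∈ Ioo s (G.graph.len e), G.edge e u₀ = G'.vertex v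
    · obtain ⟨u₀, hu₀, he₀⟩ := hex
      filter_upwards [Ioo_mem_nhdsGT hu₀.1] with u hu hc
      have := (G.edge_injective e e u ⟨hs.1.trans_lt hu.1, hu.2.trans hu₀.2⟩ u₀
        ⟨hs.1.trans_lt hu₀.1, hu₀.2⟩ (hc.trans he₀.symm)).2
      exact absurd this hu.2.ne
    · filter_upwards [Ioo_mem_nhdsGT hs.2] with u hu hc
      exact hex ⟨u, hu, hc⟩
  obtain ⟨u, h1, h2, hu⟩ := (ev1.and (ev2.and (Ioo_mem_nhdsGT hs.2))).exists
  obtain ⟨e', hp, t, ht, htu⟩ :=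
    exists_parent_of_not_vertex h (e := e) ⟨hs.1.trans_lt hu.1, hu.2⟩ h2
  refine ⟨e', hp, ?_⟩
  by_contra hne
  have hge : offset h e' ≤ s := by
    by_contra hlt
    have := h1 e' (not_le.mp hlt)
    linarith [ht.1]
  have hgt := lt_of_le_of_ne hge hne
  have hin : s - offset h e' ∈ Ioo 0 (G'.graph.len e') :=
    ⟨by linarith, by linarith [ht.2, hu.1]⟩
  refine G'.edge_ne_vertex e' _ hin v' ?_
  rw [edge_eq h e' (Ioo_subset_Icc_self hin), hp, add_sub_cancel, hv']

/-- Two edges of a refinement that overlap in the same edge are equal. -/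
theorem eq_of_overlap (h : G ≤ G') {e₁ e₂ : G'.graph.E} (hp : parent h e₁ = parent h e₂) {u : ℝ}
    (h₁ : u - offset h e₁ ∈ Ioo 0 (G'.graph.len e₁))
    (h₂ : u - offset h e₂ ∈ Ioo 0 (G'.graph.len e₂)) : e₁ = e₂ := by
  refine (G'.edge_injective e₁ e₂ _ h₁ _ h₂ ?_).1
  rw [edge_eq h e₁ (Ioo_subset_Icc_self h₁), edge_eq h e₂ (Ioo_subset_Icc_self h₂), hp,
    add_sub_cancel, add_sub_cancel]

/-- Positions on an edge of `G`, other than its start, that represent the same point. -/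
theorem pos_unique_Ioc {e : G.graph.E} {s t : ℝ} (hs : s ∈ Ioc 0 (G.graph.len e))
    (ht : t ∈ Ioc 0 (G.graph.len e)) (hst : G.edge e s = G.edge e t) : s = t := by
  rcases hs.2.lt_or_eq with h1 | h1 <;> rcases ht.2.lt_or_eq with h2 | h2
  · exact (G.edge_injective e e s ⟨hs.1, h1⟩ t ⟨ht.1, h2⟩ hst).2
  · exact absurd (hst.trans (h2 ▸ G.edge_len e)) (G.edge_ne_vertex e s ⟨hs.1, h1⟩ _)
  · exact absurd (hst.symm.trans (h1 ▸ G.edge_len e)) (G.edge_ne_vertex e t ⟨ht.1, h2⟩ _)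
  · rw [h1, h2]

/-- Positions on an edge of `G`, other than its end, that represent the same point. -/
theorem pos_unique_Ico {e : G.graph.E} {s t : ℝ} (hs : s ∈ Ico 0 (G.graph.len e))
    (ht : t ∈ Ico 0 (G.graph.len e)) (hst : G.edge e s = G.edge e t) : s = t := by
  rcases hs.1.lt_or_eq with h1 | h1 <;> rcases ht.1.lt_or_eq with h2 | h2
  · exact (G.edge_injective e e s ⟨h1, hs.2⟩ t ⟨h2, ht.2⟩ hst).2
  · exact absurd (hst.trans (h2 ▸ G.edge_zero e)) (G.edge_ne_vertex e s ⟨h1, hs.2⟩ _)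
  · exact absurd (hst.symm.trans (h1 ▸ G.edge_zero e)) (G.edge_ne_vertex e t ⟨h2, ht.2⟩ _)
  · rw [← h1, ← h2]

open scoped Classical in
theorem sum_incoming (h : G ≤ G') (ω : G.graph.E → ℝ) (v' : G'.graph.V) :
    ∑ e' with G'.graph.head e' = v', ω (parent h e') =
      ∑ e with ∃ s ∈ Ioc 0 (G.graph.len e), G.edge e s = G'.vertex v', ω e := by
  have key : ∀ e', G'.graph.head e' = v' →
      offset h e' + G'.graph.len e' ∈ Ioc 0 (G.graph.len (parent h e')) ∧
      G.edge (parent h e') (offset h e' + G'.graph.len e') = G'.vertex v' := by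
    intro e' he'
    have hl := G'.graph.len_pos e'
    refine ⟨⟨by linarith [offset_nonneg h e'], offset_add_len_le h e'⟩, ?_⟩
    rw [← edge_eq h e' ⟨hl.le, le_refl _⟩, G'.edge_len, he']
  refine Finset.sum_bij (fun e' _ => parent h e') ?_ ?_ ?_ ?_
  · intro e' he'
    simp only [Finset.mem_filter, Finset.mem_univ, true_and] at he' ⊢
    exact ⟨_, key e' he'⟩
  · intro e₁ he₁ e₂ he₂ hp
    simp only [Finset.mem_filter, Finset.mem_univ, true_and] at he₁ he₂
    obtain ⟨a₁, b₁⟩ := key e₁ he₁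
    obtain ⟨a₂, b₂⟩ := key e₂ he₂
    rw [← hp] at a₂ b₂
    have hs := pos_unique_Ioc a₁ a₂ (b₁.trans b₂.symm)
    have l₁ := G'.graph.len_pos e₁
    have l₂ := G'.graph.len_pos e₂
    have hm : 0 < min (G'.graph.len e₁) (G'.graph.len e₂) := lt_min l₁ l₂
    have hm₁ := min_le_left (G'.graph.len e₁) (G'.graph.len e₂)
    have hm₂ := min_le_right (G'.graph.len e₁) (G'.graph.len e₂)
    exact eq_of_overlap h hp (u := offset h e₁ + G'.graph.len e₁ -
      min (G'.graph.len e₁) (G'.graph.len e₂) / 2)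
      ⟨by linarith, by linarith⟩ ⟨by linarith, by linarith⟩
  · intro e he
    simp only [Finset.mem_filter, Finset.mem_univ, true_and] at he
    obtain ⟨s, hs, hes⟩ := he
    obtain ⟨e', hp, ho⟩ := exists_incoming h hs hes
    refine ⟨e', ?_, hp⟩
    simp only [Finset.mem_filter, Finset.mem_univ, true_and]
    apply G'.vertex_injective
    rw [← G'.edge_len, edge_eq h e' ⟨(G'.graph.len_pos e').le, le_refl _⟩, hp, ho, hes]
  · intro e' _
    rfl

open scoped Classical in
theorem sum_outgoing (h : G ≤ G') (ω : G.graph.E → ℝ) (v' : G'.graph.V) :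
    ∑ e' with G'.graph.tail e' = v', ω (parent h e') =
      ∑ e with ∃ s ∈ Ico 0 (G.graph.len e), G.edge e s = G'.vertex v', ω e := by
  have key : ∀ e', G'.graph.tail e' = v' →
      offset h e' ∈ Ico 0 (G.graph.len (parent h e')) ∧
      G.edge (parent h e') (offset h e') = G'.vertex v' := by
    intro e' he'
    have hl := G'.graph.len_pos e'
    refine ⟨⟨offset_nonneg h e', by linarith [offset_add_len_le h e']⟩, ?_⟩
    have := edge_eq h e' (t := 0) ⟨le_refl _, hl.le⟩
    rw [add_zero] at this
    rw [← this, G'.edge_zero, he']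
  refine Finset.sum_bij (fun e' _ => parent h e') ?_ ?_ ?_ ?_
  · intro e' he'
    simp only [Finset.mem_filter, Finset.mem_univ, true_and] at he' ⊢
    exact ⟨_, key e' he'⟩
  · intro e₁ he₁ e₂ he₂ hp
    simp only [Finset.mem_filter, Finset.mem_univ, true_and] at he₁ he₂
    obtain ⟨a₁, b₁⟩ := key e₁ he₁
    obtain ⟨a₂, b₂⟩ := key e₂ he₂
    rw [← hp] at a₂ b₂
    have hs := pos_unique_Ico a₁ a₂ (b₁.trans b₂.symm)
    have l₁ := G'.graph.len_pos e₁
    have l₂ := G'.graph.len_pos e₂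
    have hm : 0 < min (G'.graph.len e₁) (G'.graph.len e₂) := lt_min l₁ l₂
    have hm₁ := min_le_left (G'.graph.len e₁) (G'.graph.len e₂)
    have hm₂ := min_le_right (G'.graph.len e₁) (G'.graph.len e₂)
    exact eq_of_overlap h hp (u := offset h e₁ +
      min (G'.graph.len e₁) (G'.graph.len e₂) / 2)
      ⟨by linarith, by linarith⟩ ⟨by linarith, by linarith⟩
  · intro e he
    simp only [Finset.mem_filter, Finset.mem_univ, true_and] at he
    obtain ⟨s, hs, hes⟩ := he
    obtain ⟨e', hp, ho⟩ := exists_outgoing h hs hes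
    refine ⟨e', ?_, hp⟩
    simp only [Finset.mem_filter, Finset.mem_univ, true_and]
    apply G'.vertex_injective
    rw [← G'.edge_zero, edge_eq h e' ⟨le_refl _, (G'.graph.len_pos e').le⟩, hp, ho, add_zero, hes]
  · intro e' _
    rfl

/-- The push-forward of a harmonic `1`-form to a refinement is harmonic. -/
theorem comp_parent_mem (h : G ≤ G') {ω : G.graph.E → ℝ} (hω : ω ∈ G.graph.harmonicForms) :
    (fun e' => ω (parent h e')) ∈ G'.graph.harmonicForms := by
  classical
  intro v'
  have e1 := sum_incoming h ω v'
  have e2 := sum_outgoing h ω v'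
  have h3 : ∑ e with ∃ s ∈ Ioc 0 (G.graph.len e), G.edge e s = G'.vertex v', ω e =
      ∑ e with ∃ s ∈ Ico 0 (G.graph.len e), G.edge e s = G'.vertex v', ω e := by
    by_cases hv : ∃ v, G.vertex v = G'.vertex v'
    · obtain ⟨v, hv⟩ := hv
      have hv1 : ∀ e, (∃ s ∈ Ioc 0 (G.graph.len e), G.edge e s = G'.vertex v') ↔
          G.graph.head e = v := by
        intro e
        constructor
        · rintro ⟨s, hs, hes⟩
          rw [← hv] at hes
          rcases hs.2.lt_or_eq with h1 | h1
          · exact absurd hes (G.edge_ne_vertex e s ⟨hs.1, h1⟩ v)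
          · rw [h1, G.edge_len] at hes
            exact G.vertex_injective hes
        · intro he
          exact ⟨_, ⟨G.graph.len_pos e, le_refl _⟩, by rw [G.edge_len, he, hv]⟩
      have hv2 : ∀ e, (∃ s ∈ Ico 0 (G.graph.len e), G.edge e s = G'.vertex v') ↔
          G.graph.tail e = v := by
        intro e
        constructor
        · rintro ⟨s, hs, hes⟩
          rw [← hv] at hes
          rcases hs.1.lt_or_eq with h1 | h1
          · exact absurd hes (G.edge_ne_vertex e s ⟨h1, hs.2⟩ v)
          · rw [← h1, G.edge_zero] at hes
            exact G.vertex_injective hes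
        · intro he
          exact ⟨_, ⟨le_refl _, G.graph.len_pos e⟩, by rw [G.edge_zero, he, hv]⟩
      simp only [hv1, hv2]
      convert hω v
    · refine Finset.sum_congr (Finset.filter_congr fun e _ => ?_) fun _ _ => rfl
      constructor
      · rintro ⟨s, hs, hes⟩
        refine ⟨s, ⟨hs.1.le, lt_of_le_of_ne hs.2 fun hc => hv ⟨G.graph.head e, ?_⟩⟩, hes⟩
        rw [← hes, hc, G.edge_len]
      · rintro ⟨s, hs, hes⟩
        refine ⟨s, ⟨lt_of_le_of_ne hs.1 fun hc => hv ⟨G.graph.tail e, ?_⟩, hs.2.le⟩, hes⟩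
        rw [← hes, ← hc, G.edge_zero]
  convert e1.trans (h3.trans e2.symm)

/-- The push-forward `r_* : Ω(G) → Ω(G')` to a refinement, with `r_*(de)` the sum of the `de'` over
the edges `e'` into which `e` is subdivided. -/
def pushforward (h : G ≤ G') : G.graph.harmonicForms →ₗ[ℝ] G'.graph.harmonicForms where
  toFun ω := ⟨fun e' => ω.1 (parent h e'), comp_parent_mem h ω.2⟩
  map_add' _ _ := rfl
  map_smul' _ _ := rfl

/-- `R(G₀)`, the models of `Γ` that admit a common refinement with `G₀`. -/
abbrev Compatible (G₀ : Model Γ) : Type _ := {G : Model Γ // ∃ G' : Model Γ, G ≤ G' ∧ G₀ ≤ G'}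

/-- The model `G₀` itself as an element of `R(G₀)`. -/
abbrev self (G₀ : Model Γ) : Compatible G₀ := ⟨G₀, G₀, le_refl _, le_refl _⟩

open scoped Classical in
/-- `Ω(Γ)`, the space of harmonic `1`-forms on `Γ`: the direct limit of `Ω(G)` over `R(G₀)`. -/
abbrev HarmonicForms (G₀ : Model Γ) : Type _ :=
  Module.DirectLimit (R := ℝ) (fun G : Compatible G₀ => G.1.graph.harmonicForms)
    (fun _ _ h => pushforward h)

open scoped Classical in
/-- The canonical map `Ω(G) → Ω(Γ)`. -/
def toHarmonicForms (G₀ : Model Γ) (G : Compatible G₀) :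
    G.1.graph.harmonicForms →ₗ[ℝ] HarmonicForms G₀ :=
  Module.DirectLimit.of ℝ (Compatible G₀) (fun G : Compatible G₀ => G.1.graph.harmonicForms)
    (fun _ _ h => pushforward h) G

/-- The functional `φ` on `Ω(Γ)` is the integration functional `∫_α` of the integral `1`-chain `α`
of the model `G`: it sends the class of each `ω ∈ Ω(G)` to `∫_α ω`. -/
def IsIntegral (G₀ : Model Γ) (G : Compatible G₀) (α : G.1.graph.E → ℤ)
    (φ : Module.Dual ℝ (HarmonicForms G₀)) : Prop :=
  ∀ ω : G.1.graph.harmonicForms, φ (toHarmonicForms G₀ G ω) = G.1.graph.integral α ω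

/-- `H₁(Γ, ℤ)`, computed with `G₀`, as a subgroup of `Ω(Γ)*`: the functionals `∫_α` for
`α ∈ H₁(G₀, ℤ)`. -/
def cycleLattice (G₀ : Model Γ) : AddSubgroup (Module.Dual ℝ (HarmonicForms G₀)) where
  carrier := {φ | ∃ α ∈ G₀.graph.integralCycles, IsIntegral G₀ G₀.self α φ}
  add_mem' := by
    rintro φ ψ ⟨α, hα, h⟩ ⟨β, hβ, h'⟩
    refine ⟨α + β, add_mem hα hβ, fun ω => ?_⟩
    rw [LinearMap.add_apply, h ω, h' ω, map_add, LinearMap.add_apply]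
  zero_mem' := ⟨0, zero_mem _, fun ω => by rw [map_zero]; rfl⟩
  neg_mem' := by
    rintro φ ⟨α, hα, h⟩
    refine ⟨-α, neg_mem hα, fun ω => ?_⟩
    rw [LinearMap.neg_apply, h ω, map_neg, LinearMap.neg_apply]

/-- The Jacobian `J(Γ) = Ω(Γ)* / H₁(Γ, ℤ)` of a tropical curve with a given model. -/
abbrev Jacobian (G₀ : Model Γ) : Type _ :=
  Module.Dual ℝ (HarmonicForms G₀) ⧸ cycleLattice G₀

end Model

section Picard

variable (Γ : Type*) [MetricSpace Γ]

/-- The degree of a divisor on `Γ`; the group of divisors is the free abelian group on `Γ`. -/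
def degree : (Γ →₀ ℤ) →+ ℤ := Finsupp.liftAddHom fun _ => AddMonoidHom.id ℤ

/-- `Div⁰(Γ)`, the divisors of degree zero. -/
def Div0 : AddSubgroup (Γ →₀ ℤ) := (degree Γ).ker

variable {Γ}

/-- `f` is a (continuous) piecewise affine function on `Γ` with integer slopes and Laplacian `D`:
along each ray issuing from a point `p`, `f` is initially affine with an integer slope, and `D p` is
minus the sum of these outgoing slopes. (As `Γ` is compact, `f` has finitely many affine pieces.) -/
def HasLaplacian (f : Γ → ℝ) (D : Γ →₀ ℤ) : Prop :=
  ∀ p : Γ, ∀ σ : StarChart p, ∃ m : Fin σ.valence → ℤ,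
    (∀ k, ∀ᶠ t in 𝓝[>] (0 : ℝ), f (σ.ray k t) = f p + m k * t) ∧ D p = -∑ k, m k

variable (Γ)

/-- `Prin(Γ)`, the Laplacians of continuous piecewise affine functions with integer slopes. -/
def Prin : AddSubgroup (Γ →₀ ℤ) where
  carrier := {D | ∃ f : Γ → ℝ, HasLaplacian f D}
  add_mem' := by
    rintro D D' ⟨f, hf⟩ ⟨g, hg⟩
    refine ⟨f + g, fun p σ => ?_⟩
    obtain ⟨m, hm, hD⟩ := hf p σ
    obtain ⟨n, hn, hD'⟩ := hg p σ
    refine ⟨m + n, fun k => ?_, ?_⟩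
    · filter_upwards [hm k, hn k] with t h1 h2
      simp only [Pi.add_apply, h1, h2, Int.cast_add]
      ring
    · simp only [Finsupp.add_apply, Pi.add_apply, Finset.sum_add_distrib, hD, hD']
      ring
  zero_mem' := ⟨0, fun p σ => ⟨0, fun k => by simp, by simp⟩⟩
  neg_mem' := by
    rintro D ⟨f, hf⟩
    refine ⟨-f, fun p σ => ?_⟩
    obtain ⟨m, hm, hD⟩ := hf p σ
    refine ⟨-m, fun k => ?_, ?_⟩
    · filter_upwards [hm k] with t h1
      simp only [Pi.neg_apply, h1, Int.cast_neg]
      ring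
    · simp only [Finsupp.neg_apply, Pi.neg_apply, Finset.sum_neg_distrib, hD]

/-- The Picard group `Pic(Γ) = Div⁰(Γ) / Prin(Γ)`. -/
abbrev Pic : Type _ := Div0 Γ ⧸ (Prin Γ).addSubgroupOf (Div0 Γ)

variable {Γ}

theorem Model.sum_single_mem_Div0 (G : Model Γ) (α : G.graph.E → ℤ) :
    ∑ v, Finsupp.single (G.vertex v) (G.graph.dStar ℤ α v) ∈ Div0 Γ := by
  classical
  have h1 : ∑ v : G.graph.V, ∑ e with G.graph.head e = v, α e = ∑ e, α e :=
    Finset.sum_fiberwise _ _ _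
  have h2 : ∑ v : G.graph.V, ∑ e with G.graph.tail e = v, α e = ∑ e, α e :=
    Finset.sum_fiberwise _ _ _
  rw [Div0, AddMonoidHom.mem_ker, map_sum]
  simp only [degree, Finsupp.liftAddHom_apply_single, AddMonoidHom.id_apply]
  simp only [WeightedGraph.dStar, LinearMap.coe_mk, AddHom.coe_mk, Finset.sum_sub_distrib]
  rw [sub_eq_zero]
  convert h1.trans h2.symm

/-- The degree zero divisor `d*α` on `Γ`, for an integral `1`-chain `α` of a model. -/
def Model.boundary (G : Model Γ) (α : G.graph.E → ℤ) : Div0 Γ :=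
  ⟨∑ v, Finsupp.single (G.vertex v) (G.graph.dStar ℤ α v), G.sum_single_mem_Div0 α⟩

end Picard

end TropicalCurves

end

namespace TropicalCurves

/-! ### Boundaries of chains under refinement. -/

namespace Model

variable {Γ : Type*} [MetricSpace Γ] {G G' : Model Γ}

/-! The rule `∫_α ↦ [d*α]` defines a surjection from `Ω(Γ)*` to `Pic(Γ)` whose kernel is the lattice
of periods.

Passing to a refinement loses nothing. At a new vertex inside an edge exactly one piece enters and
one leaves, so a harmonic form is constant on the pieces of an edge. Hence `Ω(G) → Ω(Γ)` is
bijective for each compatible model (`toHarmonicForms_injective`, `toHarmonicForms_surjective`), and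
cycles of a refinement come from cycles of the coarser model (`exists_integralCycle_comp_parent`).
Chains pull back with the same boundary and integral (`boundary_comp_parent`,
`integral_comp_parent`), so any two can be compared on a common refinement.

Every functional is some `∫_α`: it has the form `ω ↦ ∑ ω_e c_e` with real `c_e`. Writing `c_e = n_e
s_e` with `n_e` an integer and `s_e` strictly between `0` and `ℓ(e)`, one cuts `e` at `s_e` and
gives the initial part the coefficient `n_e` (`exists_chain_isIntegral`). Every divisor of degree
zero is a boundary once its support consists of vertices (`exists_boundary_eq`).

The core is `IsIntegral.mem_cycleLattice_iff`. By duality between `d*` and the difference operator,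
`∫_α = 0` exactly when `α(e) ℓ(e) = f(e⁺) - f(e⁻)` for some `f`, that is, when `α` records the
slopes of an edgewise affine function; the Laplacian of that function is `d*α`. So if `∫_α = ∫_β`
with `β` a cycle, then `d*α = d*(α - β)` is principal. Conversely, if `d*α` is the Laplacian of `F`
with slopes `γ`, then `α - γ` is a cycle with the same integral as `α`. The second direction needs
`F` to be affine on the edges of some refinement (`HasLaplacian.exists_refinement`). This rests on
the independence of slopes from the star chart (`IsRaySystem.exists_slopes`) and on the finiteness
of breakpoints, by compactness of an edge. -/

theorem exists_vertex_eq (h : G ≤ G') (v : G.graph.V) : ∃ v', G'.vertex v' = G.vertex v := by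
  rcases G'.cover (G.vertex v) with h1 | ⟨e', t, ht, h2⟩
  · exact h1
  · rw [edge_eq h e' (Ioo_subset_Icc_self ht)] at h2
    exact absurd h2 (G.edge_ne_vertex _ _ ⟨by linarith [offset_nonneg h e', ht.1],
      by linarith [offset_add_len_le h e', ht.2]⟩ v)

theorem edge_offset (h : G ≤ G') (e' : G'.graph.E) :
    G.edge (parent h e') (offset h e') = G'.vertex (G'.graph.tail e') := by
  have := edge_eq h e' (t := 0) ⟨le_refl _, (G'.graph.len_pos e').le⟩
  rw [add_zero] at this
  rw [← this, G'.edge_zero]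

theorem edge_offset_add_len (h : G ≤ G') (e' : G'.graph.E) :
    G.edge (parent h e') (offset h e' + G'.graph.len e') = G'.vertex (G'.graph.head e') := by
  rw [← edge_eq h e' ⟨(G'.graph.len_pos e').le, le_refl _⟩, G'.edge_len]

theorem exists_Ioc_eq_vertex_iff {e : G.graph.E} {v : G.graph.V} :
    (∃ s ∈ Ioc 0 (G.graph.len e), G.edge e s = G.vertex v) ↔ G.graph.head e = v := by
  constructor
  · rintro ⟨s, hs, hes⟩
    rcases hs.2.lt_or_eq with h1 | h1
    · exact absurd hes (G.edge_ne_vertex e s ⟨hs.1, h1⟩ v)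
    · rw [h1, G.edge_len] at hes
      exact G.vertex_injective hes
  · intro he
    exact ⟨_, ⟨G.graph.len_pos e, le_refl _⟩, by rw [G.edge_len, he]⟩

theorem exists_Ico_eq_vertex_iff {e : G.graph.E} {v : G.graph.V} :
    (∃ s ∈ Ico 0 (G.graph.len e), G.edge e s = G.vertex v) ↔ G.graph.tail e = v := by
  constructor
  · rintro ⟨s, hs, hes⟩
    rcases hs.1.lt_or_eq with h1 | h1
    · exact absurd hes (G.edge_ne_vertex e s ⟨h1, hs.2⟩ v)
    · rw [← h1, G.edge_zero] at hes
      exact G.vertex_injective hes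
  · intro he
    exact ⟨_, ⟨le_refl _, G.graph.len_pos e⟩, by rw [G.edge_zero, he]⟩

theorem exists_Ioc_eq_iff_of_not_vertex {p : Γ} (hp : ∀ v, G.vertex v ≠ p) {e : G.graph.E} :
    (∃ s ∈ Ioc 0 (G.graph.len e), G.edge e s = p) ↔
      ∃ s ∈ Ico 0 (G.graph.len e), G.edge e s = p := by
  constructor
  · rintro ⟨s, hs, hes⟩
    refine ⟨s, ⟨hs.1.le, lt_of_le_of_ne hs.2 fun hc => hp (G.graph.head e) ?_⟩, hes⟩
    rw [← hes, hc, G.edge_len]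
  · rintro ⟨s, hs, hes⟩
    refine ⟨s, ⟨lt_of_le_of_ne hs.1 fun hc => hp (G.graph.tail e) ?_, hs.2.le⟩, hes⟩
    rw [← hes, ← hc, G.edge_zero]

theorem boundary_apply_vertex (G : Model Γ) (α : G.graph.E → ℤ) (v : G.graph.V) :
    (G.boundary α : Γ →₀ ℤ) (G.vertex v) = G.graph.dStar ℤ α v := by
  classical
  simp only [boundary, Finsupp.coe_finsetSum, Finset.sum_apply, Finsupp.single_apply,
    G.vertex_injective.eq_iff]
  simp

theorem boundary_apply_of_not_vertex (G : Model Γ) (α : G.graph.E → ℤ) {p : Γ}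
    (hp : ∀ v, G.vertex v ≠ p) : (G.boundary α : Γ →₀ ℤ) p = 0 := by
  classical
  simp only [boundary, Finsupp.coe_finsetSum, Finset.sum_apply, Finsupp.single_apply]
  exact Finset.sum_eq_zero fun v _ => if_neg (hp v)

open scoped Classical in
/-- The divisor `d*α` at any point, as the difference of the contributions of the edges that
arrive at the point and of those that leave it. -/
theorem boundary_apply (G : Model Γ) (α : G.graph.E → ℤ) (p : Γ) :
    (G.boundary α : Γ →₀ ℤ) p =
      ∑ e with ∃ s ∈ Ioc 0 (G.graph.len e), G.edge e s = p, α e -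
      ∑ e with ∃ s ∈ Ico 0 (G.graph.len e), G.edge e s = p, α e := by
  by_cases hp : ∃ v, G.vertex v = p
  · obtain ⟨v, rfl⟩ := hp
    rw [boundary_apply_vertex]
    simp only [exists_Ioc_eq_vertex_iff, exists_Ico_eq_vertex_iff]
    rfl
  · push Not at hp
    rw [boundary_apply_of_not_vertex G α hp]
    simp only [exists_Ioc_eq_iff_of_not_vertex hp, sub_self]

/-- At a vertex of `G'`, the pieces that arrive or leave correspond to the edges of `G` that arrive
or leave there; any other point is a vertex of neither model. -/
theorem boundary_comp_parent (h : G ≤ G') (α : G.graph.E → ℤ) :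
    G'.boundary (α ∘ parent h) = G.boundary α := by
  classical
  refine Subtype.ext (Finsupp.ext fun p => ?_)
  by_cases hp : ∃ v', G'.vertex v' = p
  · obtain ⟨v', rfl⟩ := hp
    have h1 := sum_incoming h (fun e => (α e : ℝ)) v'
    have h2 := sum_outgoing h (fun e => (α e : ℝ)) v'
    rw [boundary_apply_vertex, boundary_apply]
    have : G'.graph.dStar ℤ (α ∘ parent h) v' =
      (∑ e' with G'.graph.head e' = v', α (parent h e')) -
        ∑ e' with G'.graph.tail e' = v', α (parent h e') := by
      simp only [WeightedGraph.dStar, LinearMap.coe_mk, AddHom.coe_mk, Function.comp]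
    rw [this]
    norm_cast at h1 h2
    convert congrArg₂ (· - ·) h1 h2
  · push Not at hp
    rw [boundary_apply_of_not_vertex _ _ hp, boundary_apply_of_not_vertex]
    intro v hv
    obtain ⟨v', hv'⟩ := exists_vertex_eq h v
    exact hp v' (hv'.trans hv)

/-- The boundary of chains, as a homomorphism. -/
noncomputable def boundaryHom (G : Model Γ) : (G.graph.E → ℤ) →+ Div0 Γ :=
  AddMonoidHom.mk' G.boundary fun α β => by
    refine Subtype.ext ?_
    simp only [boundary, map_add, Pi.add_apply, Finsupp.single_add, Finset.sum_add_distrib,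
      AddSubgroup.coe_add]

theorem boundary_add (G : Model Γ) (α β : G.graph.E → ℤ) :
    G.boundary (α + β) = G.boundary α + G.boundary β := map_add G.boundaryHom α β

theorem boundary_sub (G : Model Γ) (α β : G.graph.E → ℤ) :
    G.boundary (α - β) = G.boundary α - G.boundary β := map_sub G.boundaryHom α β

theorem boundary_eq_zero_iff (G : Model Γ) (α : G.graph.E → ℤ) :
    G.boundary α = 0 ↔ α ∈ G.graph.integralCycles := by
  constructor
  · intro h
    refine (AddMonoidHom.mem_ker).2 (funext fun v => ?_)
    have := G.boundary_apply_vertex α v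
    rw [h] at this
    exact this.symm
  · intro h
    have h' : G.graph.dStar ℤ α = 0 := h
    refine Subtype.ext ?_
    simp [boundary, h']

/-- Vertices of `G` remain vertices of `G'`, with the same incoming and outgoing sums. -/
theorem mem_harmonicForms_of_comp_parent (h : G ≤ G') {ω : G.graph.E → ℝ}
    (hω : ω ∘ parent h ∈ G'.graph.harmonicForms) : ω ∈ G.graph.harmonicForms := by
  classical
  intro v
  obtain ⟨v', hv'⟩ := exists_vertex_eq h v
  have h1 := sum_incoming h ω v'
  have h2 := sum_outgoing h ω v'
  simp only [hv', exists_Ioc_eq_vertex_iff, exists_Ico_eq_vertex_iff] at h1 h2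
  have h3 := hω v'
  simp only [Function.comp] at h3
  convert h1.symm.trans (Eq.trans (by convert h3) h2)

/-! ### Harmonic forms and cycles on a refinement. -/

/-- An interior point of an edge of `G` is the endpoint of at most one edge of the refinement. -/
theorem eq_of_head_interior (h : G ≤ G') {e : G.graph.E} {s : ℝ} (hs : s ∈ Ioo 0 (G.graph.len e))
    {e₁ e₂ : G'.graph.E} (h₁ : G'.vertex (G'.graph.head e₁) = G.edge e s)
    (h₂ : G'.vertex (G'.graph.head e₂) = G.edge e s) : e₁ = e₂ := by
  have key : ∀ a : G'.graph.E, G'.vertex (G'.graph.head a) = G.edge e s →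
      parent h a = e ∧ offset h a + G'.graph.len a = s := by
    intro a ha
    rw [← edge_offset_add_len h a] at ha
    have h0 := offset_nonneg h a
    have h1 := G'.graph.len_pos a
    rcases (offset_add_len_le h a).lt_or_eq with hlt | heq
    · exact G.edge_injective _ _ _ ⟨by linarith, hlt⟩ _ hs ha
    · rw [heq, G.edge_len] at ha
      exact absurd ha.symm (G.edge_ne_vertex e s hs _)
  obtain ⟨p₁, o₁⟩ := key e₁ h₁
  obtain ⟨p₂, o₂⟩ := key e₂ h₂
  have l₁ := G'.graph.len_pos e₁
  have l₂ := G'.graph.len_pos e₂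
  have hm : 0 < min (G'.graph.len e₁) (G'.graph.len e₂) := lt_min l₁ l₂
  have hm₁ := min_le_left (G'.graph.len e₁) (G'.graph.len e₂)
  have hm₂ := min_le_right (G'.graph.len e₁) (G'.graph.len e₂)
  exact eq_of_overlap h (p₁.trans p₂.symm)
    (u := s - min (G'.graph.len e₁) (G'.graph.len e₂) / 2)
    ⟨by linarith, by linarith⟩ ⟨by linarith, by linarith⟩

theorem eq_of_tail_interior (h : G ≤ G') {e : G.graph.E} {s : ℝ} (hs : s ∈ Ioo 0 (G.graph.len e))
    {e₁ e₂ : G'.graph.E} (h₁ : G'.vertex (G'.graph.tail e₁) = G.edge e s)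
    (h₂ : G'.vertex (G'.graph.tail e₂) = G.edge e s) : e₁ = e₂ := by
  have key : ∀ a : G'.graph.E, G'.vertex (G'.graph.tail a) = G.edge e s →
      parent h a = e ∧ offset h a = s := by
    intro a ha
    rw [← edge_offset h a] at ha
    have h0 := offset_add_len_le h a
    have h1 := G'.graph.len_pos a
    rcases (offset_nonneg h a).lt_or_eq with hlt | heq
    · exact G.edge_injective _ _ _ ⟨hlt, by linarith⟩ _ hs ha
    · rw [← heq, G.edge_zero] at ha
      exact absurd ha.symm (G.edge_ne_vertex e s hs _)
  obtain ⟨p₁, o₁⟩ := key e₁ h₁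
  obtain ⟨p₂, o₂⟩ := key e₂ h₂
  have l₁ := G'.graph.len_pos e₁
  have l₂ := G'.graph.len_pos e₂
  have hm : 0 < min (G'.graph.len e₁) (G'.graph.len e₂) := lt_min l₁ l₂
  have hm₁ := min_le_left (G'.graph.len e₁) (G'.graph.len e₂)
  have hm₂ := min_le_right (G'.graph.len e₁) (G'.graph.len e₂)
  exact eq_of_overlap h (p₁.trans p₂.symm)
    (u := s + min (G'.graph.len e₁) (G'.graph.len e₂) / 2)
    ⟨by linarith, by linarith⟩ ⟨by linarith, by linarith⟩

/-- Every edge is covered, from its start, by edges of the refinement. -/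
theorem exists_offset_eq_zero (h : G ≤ G') (e : G.graph.E) :
    ∃ e', parent h e' = e ∧ offset h e' = 0 := by
  obtain ⟨v', hv'⟩ := exists_vertex_eq h (G.graph.tail e)
  exact exists_outgoing h ⟨le_refl _, G.graph.len_pos e⟩ (by rw [G.edge_zero, hv'])

theorem parent_surjective (h : G ≤ G') : Function.Surjective (parent h) := fun e =>
  let ⟨e', he', _⟩ := exists_offset_eq_zero h e
  ⟨e', he'⟩

/-- A harmonic form on a refinement takes the same value on consecutive pieces of an edge. -/
theorem harmonic_eq_of_consecutive (h : G ≤ G') {ω : G'.graph.E → ℝ}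
    (hω : ω ∈ G'.graph.harmonicForms) {e₁ e₂ : G'.graph.E} (hp : parent h e₁ = parent h e₂)
    (ho : offset h e₁ + G'.graph.len e₁ = offset h e₂) : ω e₁ = ω e₂ := by
  classical
  have l₁ := G'.graph.len_pos e₁
  have l₂ := G'.graph.len_pos e₂
  have hs : offset h e₂ ∈ Ioo 0 (G.graph.len (parent h e₂)) :=
    ⟨by linarith [offset_nonneg h e₁], by linarith [offset_add_len_le h e₂]⟩
  have h1 : G'.vertex (G'.graph.head e₁) = G.edge (parent h e₂) (offset h e₂) := by
    rw [← edge_offset_add_len h, hp, ho]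
  have h2 : G'.vertex (G'.graph.tail e₂) = G.edge (parent h e₂) (offset h e₂) :=
    (edge_offset h e₂).symm
  have h12 : G'.graph.head e₁ = G'.graph.tail e₂ := G'.vertex_injective (h1.trans h2.symm)
  have e1 : ∑ e with G'.graph.head e = G'.graph.head e₁, ω e = ω e₁ := by
    rw [← Finset.sum_singleton ω e₁]
    congr 1
    ext a
    simp only [Finset.mem_filter, Finset.mem_univ, true_and, Finset.mem_singleton]
    refine ⟨fun ha => eq_of_head_interior h hs (by rw [ha, h1]) h1, fun ha => by rw [ha]⟩
  have e2 : ∑ e with G'.graph.tail e = G'.graph.head e₁, ω e = ω e₂ := by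
    rw [← Finset.sum_singleton ω e₂]
    congr 1
    ext a
    simp only [Finset.mem_filter, Finset.mem_univ, true_and, Finset.mem_singleton]
    refine ⟨fun ha => eq_of_tail_interior h hs (by rw [ha, h1]) h2, fun ha => by rw [ha, h12]⟩
  rw [← e1, ← e2]
  convert hω (G'.graph.head e₁)

theorem exists_preceding (h : G ≤ G') (e' : G'.graph.E) (h0 : offset h e' ≠ 0) :
    ∃ e'', parent h e'' = parent h e' ∧ offset h e'' + G'.graph.len e'' = offset h e' :=
  exists_incoming h ⟨lt_of_le_of_ne (offset_nonneg h e') h0.symm,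
    by linarith [offset_add_len_le h e', G'.graph.len_pos e']⟩ (edge_offset h e')

/-- Each piece is compared with the first piece of its edge, by induction on the offset; this order
is well founded because there are finitely many pieces. -/
theorem harmonic_eq_of_parent_eq (h : G ≤ G') {ω : G'.graph.E → ℝ}
    (hω : ω ∈ G'.graph.harmonicForms) {e₁ e₂ : G'.graph.E} (hp : parent h e₁ = parent h e₂) :
    ω e₁ = ω e₂ := by
  obtain ⟨a, hpa, hoa⟩ := exists_offset_eq_zero h (parent h e₁)
  have wf : WellFounded (InvImage (· < ·) (offset h)) :=
    have : IsTrans G'.graph.E (InvImage (· < ·) (offset h)) := ⟨fun _ _ _ => lt_trans⟩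
    have : Std.Irrefl (InvImage (· < ·) (offset h)) := ⟨fun _ => lt_irrefl _⟩
    Finite.wellFounded_of_trans_of_irrefl _
  have key : ∀ b, parent h b = parent h e₁ → ω b = ω a := by
    intro b
    induction b using wf.induction with
    | _ b ih =>
      intro hb
      by_cases h0 : offset h b = 0
      -- Two pieces starting at `0` overlap, so they coincide.
      · have la := G'.graph.len_pos a
        have lb := G'.graph.len_pos b
        have hm : 0 < min (G'.graph.len a) (G'.graph.len b) := lt_min la lb
        have hm₁ := min_le_left (G'.graph.len a) (G'.graph.len b)
        have hm₂ := min_le_right (G'.graph.len a) (G'.graph.len b)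
        rw [eq_of_overlap h (hb.trans hpa.symm) (u := min (G'.graph.len a) (G'.graph.len b) / 2)
          ⟨by linarith, by linarith⟩ ⟨by linarith, by linarith⟩]
      · obtain ⟨c, hc, hoc⟩ := exists_preceding h b h0
        rw [← harmonic_eq_of_consecutive h hω hc hoc]
        exact ih c (by
          have := G'.graph.len_pos c
          change offset h c < offset h b
          linarith) (hc.trans hb)
  rw [key e₁ rfl, key e₂ hp.symm]

theorem exists_eq_comp_parent {A : Type*} (h : G ≤ G') {ω : G'.graph.E → A}
    (hω : ∀ e₁ e₂, parent h e₁ = parent h e₂ → ω e₁ = ω e₂) :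
    ∃ ω₀ : G.graph.E → A, ω₀ ∘ parent h = ω := by
  choose g hg using parent_surjective h
  exact ⟨ω ∘ g, funext fun e' => hω _ _ (hg _)⟩

theorem pushforward_surjective (h : G ≤ G') : Function.Surjective (pushforward h) := by
  rintro ⟨ω, hω⟩
  obtain ⟨ω₀, rfl⟩ := exists_eq_comp_parent h fun _ _ => harmonic_eq_of_parent_eq h hω
  exact ⟨⟨ω₀, mem_harmonicForms_of_comp_parent h hω⟩, rfl⟩

theorem pushforward_injective (h : G ≤ G') : Function.Injective (pushforward h) := by
  intro ω η hωη
  refine Subtype.ext (funext fun e => ?_)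
  obtain ⟨e', rfl⟩ := parent_surjective h e
  exact congrFun (congrArg Subtype.val hωη) e'

theorem cast_mem_harmonicForms {α : G.graph.E → ℤ} (hα : α ∈ G.graph.integralCycles) :
    (fun e => (α e : ℝ)) ∈ G.graph.harmonicForms := by
  intro v
  have h : G.graph.dStar ℤ α v = 0 := congrFun (show G.graph.dStar ℤ α = 0 from hα) v
  beta_reduce
  exact_mod_cast sub_eq_zero.1 h

/-- An integral cycle is in particular a harmonic form, hence constant on the pieces of an edge.
This is why the period lattice can be computed with `G₀` alone. -/
theorem exists_integralCycle_comp_parent (h : G ≤ G') {α : G'.graph.E → ℤ}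
    (hα : α ∈ G'.graph.integralCycles) :
    ∃ β ∈ G.graph.integralCycles, β ∘ parent h = α := by
  obtain ⟨β, rfl⟩ := exists_eq_comp_parent h (ω := α) fun _ _ hp =>
    Int.cast_injective (harmonic_eq_of_parent_eq h (cast_mem_harmonicForms hα) hp)
  refine ⟨β, ?_, rfl⟩
  rw [← boundary_eq_zero_iff] at hα ⊢
  rw [← hα, boundary_comp_parent]

/-! ### Lengths and integrals under refinement. -/

open scoped Classical in
/-- The total length of the pieces of the edge `e` up to a vertex at position `s`. -/
theorem sum_len_le (h : G ≤ G') {e : G.graph.E} {s : ℝ} (hs : s ∈ Icc 0 (G.graph.len e))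
    (hv : ∃ v', G'.vertex v' = G.edge e s) :
    ∑ e' with parent h e' = e ∧ offset h e' + G'.graph.len e' ≤ s, G'.graph.len e' = s := by
  have wf : WellFounded (InvImage (· < ·) (offset h)) :=
    have : IsTrans G'.graph.E (InvImage (· < ·) (offset h)) := ⟨fun _ _ _ => lt_trans⟩
    have : Std.Irrefl (InvImage (· < ·) (offset h)) := ⟨fun _ => lt_irrefl _⟩
    Finite.wellFounded_of_trans_of_irrefl _
  have zero : ∑ e' with parent h e' = e ∧ offset h e' + G'.graph.len e' ≤ 0,
      G'.graph.len e' = 0 := by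
    refine Finset.sum_eq_zero fun e' he' => ?_
    have := (Finset.mem_filter.1 he').2.2
    linarith [offset_nonneg h e', G'.graph.len_pos e']
  -- A piece that ends after the start of `b` but not after its end overlaps `b`, so `b` is the only
  -- new summand.
  have step : ∀ b, parent h b = e →
      ∑ e' with parent h e' = e ∧ offset h e' + G'.graph.len e' ≤ offset h b + G'.graph.len b,
        G'.graph.len e' =
      G'.graph.len b +
        ∑ e' with parent h e' = e ∧ offset h e' + G'.graph.len e' ≤ offset h b,
          G'.graph.len e' := by
    intro b hb
    have lb := G'.graph.len_pos b
    rw [← Finset.sum_insert (a := b)]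
    · congr 1
      ext a
      simp only [Finset.mem_filter, Finset.mem_univ, true_and, Finset.mem_insert]
      constructor
      · rintro ⟨h1, h2⟩
        rw [or_iff_not_imp_right]
        intro h3
        have h4 : offset h b < offset h a + G'.graph.len a := by
          by_contra h5
          exact h3 ⟨h1, not_lt.1 h5⟩
        have la := G'.graph.len_pos a
        have m1 := le_max_left (offset h a) (offset h b)
        have m2 := le_max_right (offset h a) (offset h b)
        have m3 : max (offset h a) (offset h b) < offset h a + G'.graph.len a :=
          max_lt (by linarith) h4
        exact eq_of_overlap h (h1.trans hb.symm)
          (u := (max (offset h a) (offset h b) + (offset h a + G'.graph.len a)) / 2)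
          ⟨by linarith, by linarith⟩ ⟨by linarith, by linarith⟩
      · rintro (rfl | ⟨h1, h2⟩)
        · exact ⟨hb, le_refl _⟩
        · exact ⟨h1, by linarith⟩
    · simp only [Finset.mem_filter, Finset.mem_univ, true_and, not_and, not_le]
      intro _
      linarith
  have key : ∀ b, parent h b = e →
      ∑ e' with parent h e' = e ∧ offset h e' + G'.graph.len e' ≤ offset h b,
        G'.graph.len e' = offset h b := by
    intro b
    induction b using wf.induction with
    | _ b ih =>
      intro hb
      by_cases h0 : offset h b = 0
      · rw [h0, zero]
      · obtain ⟨c, hc, hoc⟩ := exists_preceding h b h0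
        rw [← hoc, step c (hc.trans hb), ih c _ (hc.trans hb), add_comm]
        have := G'.graph.len_pos c
        change offset h c < offset h b
        linarith
  rcases hs.1.lt_or_eq with h0 | h0
  · obtain ⟨v', hv'⟩ := hv
    obtain ⟨b, hb, hob⟩ := exists_incoming h ⟨h0, hs.2⟩ hv'.symm
    rw [← hob, step b hb, key b hb, add_comm]
  · rw [← h0, zero]

open scoped Classical in
theorem sum_len_parent (h : G ≤ G') (e : G.graph.E) :
    ∑ e' with parent h e' = e, G'.graph.len e' = G.graph.len e := by
  obtain ⟨v', hv'⟩ := exists_vertex_eq h (G.graph.head e)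
  rw [← sum_len_le h (e := e) (s := G.graph.len e) ⟨(G.graph.len_pos e).le, le_refl _⟩
    ⟨v', by rw [hv', G.edge_len]⟩]
  refine Finset.sum_congr (Finset.filter_congr fun a _ => ?_) fun _ _ => rfl
  exact ⟨fun ha => ⟨ha, ha ▸ offset_add_len_le h a⟩, And.left⟩

theorem integral_apply (G : WeightedGraph) (α : G.E → ℤ) (ω : G.harmonicForms) :
    G.integral α ω = ∑ e, (α e : ℝ) * ω.1 e * G.len e := rfl

theorem integral_comp_parent (h : G ≤ G') (α : G.graph.E → ℤ) (ω : G.graph.harmonicForms) :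
    G'.graph.integral (α ∘ parent h) (pushforward h ω) = G.graph.integral α ω := by
  classical
  rw [integral_apply, integral_apply, ← Finset.sum_fiberwise _ (parent h)]
  refine Finset.sum_congr rfl fun e _ => ?_
  rw [← sum_len_parent h e, Finset.mul_sum]
  refine Finset.sum_congr rfl fun e' he' => ?_
  rw [← (Finset.mem_filter.1 he').2]
  rfl

end Model

/-! ### Subdivision and common refinements. -/

namespace WeightedGraph

open scoped Classical in
/-- The weighted graph obtained by subdividing the edge `a` at distance `s` from its tail: the
edge `some a` is the part before the new vertex `none`, and the edge `none` the part after. -/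
noncomputable def subdivide (G : WeightedGraph) (a : G.E) {s : ℝ} (hs : s ∈ Ioo 0 (G.len a)) :
    WeightedGraph where
  V := Option G.V
  E := Option G.E
  len e := e.elim (G.len a - s) fun e => if e = a then s else G.len e
  len_pos e := by
    rcases e with _ | e
    · simpa using hs.2
    · simp only [Option.elim_some]
      split_ifs
      · exact hs.1
      · exact G.len_pos e
  tail e := e.elim none fun e => some (G.tail e)
  head e := e.elim (some (G.head a)) fun e => if e = a then none else some (G.head e)
  connected := by
    set R : Option G.V → Option G.V → Prop := fun x y => ∃ e : Option G.E,
      (e.elim none (fun e => some (G.tail e)) = x ∧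
        e.elim (some (G.head a)) (fun e => if e = a then none else some (G.head e)) = y) ∨
      (e.elim none (fun e => some (G.tail e)) = y ∧
        e.elim (some (G.head a)) (fun e => if e = a then none else some (G.head e)) = x) with hR
    have symm : ∀ x y, Relation.ReflTransGen R x y → Relation.ReflTransGen R y x := by
      have : Std.Symm R := ⟨fun x y ⟨e, he⟩ => ⟨e, he.symm⟩⟩
      exact fun x y hxy => Relation.ReflTransGen.stdSymm.symm _ _ hxy
    have h1 : Relation.ReflTransGen R (some (G.tail a)) none :=
      .single ⟨some a, Or.inl ⟨rfl, by simp⟩⟩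
    have h2 : Relation.ReflTransGen R none (some (G.head a)) :=
      .single ⟨none, Or.inl ⟨rfl, rfl⟩⟩
    have edge : ∀ e, Relation.ReflTransGen R (some (G.tail e)) (some (G.head e)) := by
      intro e
      by_cases he : e = a
      · rw [he]
        exact h1.trans h2
      · exact .single ⟨some e, Or.inl ⟨rfl, by simp [he]⟩⟩
    have old : ∀ x y : G.V, Relation.ReflTransGen R (some x) (some y) := by
      intro x y
      induction G.connected x y with
      | refl => exact .refl
      | tail _ hbc ih =>
        obtain ⟨e, ⟨rfl, rfl⟩ | ⟨rfl, rfl⟩⟩ := hbc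
        · exact ih.trans (edge e)
        · exact ih.trans (symm _ _ (edge e))
    rintro (_ | x) (_ | y)
    · exact .refl
    · exact h2.trans (old _ _)
    · exact (old _ _).trans h1
    · exact old x y

end WeightedGraph

namespace Model

variable {Γ : Type*} [MetricSpace Γ] {G₀ G G' : Model Γ}

open scoped Classical in
/-- The model obtained by making an interior point of an edge a vertex. -/
noncomputable def subdivide (G : Model Γ) (a : G.graph.E) {s : ℝ}
    (hs : s ∈ Ioo 0 (G.graph.len a)) : Model Γ where
  graph := G.graph.subdivide a hs
  vertex v := v.elim (G.edge a s) G.vertex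
  vertex_injective := by
    rintro (_ | v) (_ | w) h
    · rfl
    · exact absurd h (G.edge_ne_vertex a s hs w)
    · exact absurd h.symm (G.edge_ne_vertex a s hs v)
    · exact congrArg some (G.vertex_injective h)
  edge e t := e.elim (G.edge a (s + t)) fun e => G.edge e t
  edge_zero := by
    rintro (_ | e)
    · simp [WeightedGraph.subdivide]
    · exact G.edge_zero e
  edge_len := by
    rintro (_ | e)
    · simpa [WeightedGraph.subdivide] using G.edge_len a
    · by_cases he : e = a
      · simp [WeightedGraph.subdivide, he]
      · simpa [WeightedGraph.subdivide, he] using G.edge_len e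
  edge_ne_vertex := by
    rintro (_ | e) t ht v
    · simp only [WeightedGraph.subdivide, Option.elim_none] at ht
      have hst : s + t ∈ Ioo 0 (G.graph.len a) := ⟨by linarith [hs.1, ht.1], by linarith [ht.2]⟩
      rcases v with _ | v
      · intro h
        have := (G.edge_injective a a _ hst _ hs h).2
        linarith [ht.1]
      · exact G.edge_ne_vertex a _ hst v
    · by_cases he : e = a
      · subst he
        simp only [WeightedGraph.subdivide, Option.elim_some, if_true] at ht
        have ht' : t ∈ Ioo 0 (G.graph.len e) := ⟨ht.1, ht.2.trans hs.2⟩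
        rcases v with _ | v
        · intro h
          have := (G.edge_injective e e _ ht' _ hs h).2
          linarith [ht.2]
        · exact G.edge_ne_vertex e _ ht' v
      · simp only [WeightedGraph.subdivide, Option.elim_some, if_neg he] at ht
        rcases v with _ | v
        · intro h
          exact he (G.edge_injective e a _ ht _ hs h).1
        · exact G.edge_ne_vertex e _ ht v
  edge_injective := by
    have key : ∀ (e : G.graph.E) (t : ℝ), t ∈ Ioo 0 ((G.graph.subdivide a hs).len (some e)) →
        t ∈ Ioo 0 (G.graph.len e) ∧ (e = a → t < s) := by
      intro e t ht
      by_cases he : e = a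
      · subst he
        simp only [WeightedGraph.subdivide, Option.elim_some, if_true] at ht
        exact ⟨⟨ht.1, ht.2.trans hs.2⟩, fun _ => ht.2⟩
      · simp only [WeightedGraph.subdivide, Option.elim_some, if_neg he] at ht
        exact ⟨ht, fun h => absurd h he⟩
    have key' : ∀ t : ℝ, t ∈ Ioo 0 ((G.graph.subdivide a hs).len none) →
        s + t ∈ Ioo 0 (G.graph.len a) := by
      intro t ht
      simp only [WeightedGraph.subdivide, Option.elim_none] at ht
      exact ⟨by linarith [hs.1, ht.1], by linarith [ht.2]⟩
    rintro (_ | e) (_ | e') t ht t' ht' h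
    · exact ⟨rfl, by linarith [(G.edge_injective a a _ (key' t ht) _ (key' t' ht') h).2]⟩
    · obtain ⟨h1, h2⟩ := G.edge_injective a e' _ (key' t ht) _ (key e' t' ht').1 h
      linarith [(key e' t' ht').2 h1.symm, ht.1]
    · obtain ⟨h1, h2⟩ := G.edge_injective e a _ (key e t ht).1 _ (key' t' ht') h
      linarith [(key e t ht).2 h1, ht'.1]
    · obtain ⟨h1, h2⟩ := G.edge_injective e e' _ (key e t ht).1 _ (key e' t' ht').1 h
      exact ⟨congrArg some h1, h2⟩
  cover := by
    intro p
    rcases G.cover p with ⟨v, hv⟩ | ⟨e, t, ht, het⟩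
    · exact Or.inl ⟨some v, hv⟩
    · by_cases he : e = a
      · subst he
        rcases lt_trichotomy t s with h | h | h
        · exact Or.inr ⟨some e, t, by simpa [WeightedGraph.subdivide] using ⟨ht.1, h⟩, het⟩
        · exact Or.inl ⟨none, by rw [← het, h]; rfl⟩
        · refine Or.inr ⟨none, t - s, ?_, by simpa using het⟩
          simp only [WeightedGraph.subdivide, Option.elim_none]
          exact ⟨by linarith, by linarith [ht.2]⟩
      · exact Or.inr ⟨some e, t, by simpa [WeightedGraph.subdivide, he] using ht, het⟩
  locally_isometric := by
    rintro (_ | e)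
    · obtain ⟨ε, hε, h⟩ := G.locally_isometric a
      refine ⟨ε, hε, fun u hu t ht hut => ?_⟩
      simp only [WeightedGraph.subdivide, Option.elim_none] at hu ht
      have := h (s + u) ⟨by linarith [hs.1, hu.1], by linarith [hu.2]⟩ (s + t)
        ⟨by linarith [hs.1, ht.1], by linarith [ht.2]⟩ (by rwa [add_sub_add_left_eq_sub])
      rwa [add_sub_add_left_eq_sub] at this
    · obtain ⟨ε, hε, h⟩ := G.locally_isometric e
      refine ⟨ε, hε, fun u hu t ht hut => ?_⟩
      have key : ∀ x, x ∈ Icc 0 ((G.graph.subdivide a hs).len (some e)) →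
          x ∈ Icc 0 (G.graph.len e) := by
        intro x hx
        by_cases he : e = a
        · subst he
          simp only [WeightedGraph.subdivide, Option.elim_some, if_true] at hx
          exact ⟨hx.1, hx.2.trans hs.2.le⟩
        · simpa only [WeightedGraph.subdivide, Option.elim_some, if_neg he] using hx
      exact h u (key u hu) t (key t ht) hut

theorem le_subdivide (G : Model Γ) (a : G.graph.E) {s : ℝ} (hs : s ∈ Ioo 0 (G.graph.len a)) :
    G ≤ G.subdivide a hs := by
  classical
  rintro (_ | e)
  · exact ⟨a, s, hs.1.le, by simp [subdivide, WeightedGraph.subdivide], fun t _ => rfl⟩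
  · refine ⟨e, 0, le_refl _, ?_, fun t _ => by rw [zero_add]; rfl⟩
    by_cases he : e = a
    · subst he
      simpa [subdivide, WeightedGraph.subdivide] using hs.2.le
    · simp [subdivide, WeightedGraph.subdivide, he]

/-- Any finite set of points is contained in the vertex set of a refinement. -/
theorem exists_refinement (G : Model Γ) (S : Set Γ) (hS : S.Finite) :
    ∃ G', G ≤ G' ∧ ∀ p ∈ S, ∃ v, G'.vertex v = p := by
  induction S, hS using Set.Finite.induction_on with
  | empty => exact ⟨G, le_refl _, by simp⟩
  | @insert p S _ _ ih =>
    obtain ⟨G', h, hG'⟩ := ih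
    have step : ∃ G'', G' ≤ G'' ∧ ∃ v, G''.vertex v = p := by
      rcases G'.cover p with hv | ⟨e, t, ht, het⟩
      · exact ⟨G', le_refl _, hv⟩
      · exact ⟨G'.subdivide e ht, G'.le_subdivide e ht, none, het⟩
    obtain ⟨G'', h', hv⟩ := step
    refine ⟨G'', h.trans h', fun q hq => ?_⟩
    rcases hq with rfl | hq
    · exact hv
    · obtain ⟨w, rfl⟩ := hG' q hq
      exact exists_vertex_eq h' w

/-- Among the refinements of a model, those with more vertices are finer. -/
theorem le_of_vertex (h : G₀ ≤ G) (h' : G₀ ≤ G')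
    (hv : ∀ v, ∃ v', G'.vertex v' = G.vertex v) : G ≤ G' := by
  intro e'
  have l' := G'.graph.len_pos e'
  have h0 := offset_nonneg h' e'
  have h1 := offset_add_len_le h' e'
  -- Vertices of `G` are vertices of `G'`, so none lies inside a piece of `G'`.
  have clear : ∀ u ∈ Ioo (offset h' e') (offset h' e' + G'.graph.len e'), ∀ v,
      G₀.edge (parent h' e') u ≠ G.vertex v := by
    intro u hu v huv
    obtain ⟨v', hv'⟩ := hv v
    have hin : u - offset h' e' ∈ Ioo 0 (G'.graph.len e') :=
      ⟨by linarith [hu.1], by linarith [hu.2]⟩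
    refine G'.edge_ne_vertex e' _ hin v' ?_
    rw [edge_eq h' e' (Ioo_subset_Icc_self hin), add_sub_cancel, huv, hv']
  -- The midpoint of `e'` selects the edge `e` of `G`; the ends of `e` cannot lie inside `e'`, so
  -- `e` contains all of `e'`.
  have hmid : offset h' e' + G'.graph.len e' / 2 ∈
      Ioo (offset h' e') (offset h' e' + G'.graph.len e') := ⟨by linarith, by linarith⟩
  obtain ⟨e, hp, t, ht, hot⟩ := exists_parent_of_not_vertex h (e := parent h' e')
    (u := offset h' e' + G'.graph.len e' / 2) ⟨by linarith, by linarith⟩ (clear _ hmid)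
  have l := G.graph.len_pos e
  have a1 : offset h e ≤ offset h' e' := by
    by_contra hlt
    refine clear (offset h e) ⟨not_le.1 hlt, by linarith [ht.1]⟩ (G.graph.tail e) ?_
    rw [← hp, edge_offset]
  have a2 : offset h' e' + G'.graph.len e' ≤ offset h e + G.graph.len e := by
    by_contra hlt
    refine clear (offset h e + G.graph.len e) ⟨by linarith [ht.2], not_le.1 hlt⟩
      (G.graph.head e) ?_
    rw [← hp, edge_offset_add_len]
  refine ⟨e, offset h' e' - offset h e, by linarith, by linarith, fun t ht => ?_⟩
  rw [edge_eq h' e' ht, edge_eq h e ⟨by linarith [ht.1], by linarith [ht.2]⟩, hp]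
  congr 1
  ring

/-- A model finer than `G₀` as an element of `R(G₀)`. -/
abbrev refined (h : G₀ ≤ G) : Compatible G₀ := ⟨G, G, le_refl _, h⟩

/-- Each model shares a refinement with `G₀`. Adding the vertices of both of these to `G₀` gives a
model finer than each, since refinements of one model are ordered by their vertices. -/
theorem exists_common_refinement (G₁ G₂ : Compatible G₀) :
    ∃ G : Model Γ, G₁.1 ≤ G ∧ G₂.1 ≤ G ∧ G₀ ≤ G := by
  obtain ⟨_, H₁, h₁, k₁⟩ := G₁
  obtain ⟨_, H₂, h₂, k₂⟩ := G₂
  obtain ⟨G, hG, hv⟩ := exists_refinement G₀ (range H₁.vertex ∪ range H₂.vertex)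
    ((finite_range _).union (finite_range _))
  exact ⟨G, h₁.trans (le_of_vertex k₁ hG fun v => hv _ (Or.inl ⟨v, rfl⟩)),
    h₂.trans (le_of_vertex k₂ hG fun v => hv _ (Or.inr ⟨v, rfl⟩)), hG⟩

/-! ### The direct limit of harmonic forms and its integration functionals. -/

instance : IsDirectedOrder (Compatible G₀) :=
  ⟨fun G₁ G₂ =>
    let ⟨_, h₁, h₂, h⟩ := exists_common_refinement G₁ G₂
    ⟨refined h, h₁, h₂⟩⟩

theorem toHarmonicForms_pushforward {G G' : Compatible G₀} (h : G.1 ≤ G'.1)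
    (ω : G.1.graph.harmonicForms) :
    toHarmonicForms G₀ G' (pushforward h ω) = toHarmonicForms G₀ G ω := by
  classical
  exact Module.DirectLimit.of_f (f := fun (G G' : Compatible G₀) (h : G ≤ G') => pushforward h)
    (hij := h)

/-- Parents are chosen, but the midpoint of `e` is interior to only one edge of `G`. This
compatibility makes the forms a directed system. -/
theorem parent_trans {G'' : Model Γ} (h : G ≤ G') (h' : G' ≤ G'') (e : G''.graph.E) :
    parent h (parent h' e) = parent (h.trans h') e := by
  have l := G''.graph.len_pos e
  have m : G''.graph.len e / 2 ∈ Ioo 0 (G''.graph.len e) := ⟨by linarith, by linarith⟩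
  have a1 := offset_nonneg h (parent h' e)
  have a2 := offset_nonneg h' e
  have b1 := offset_add_len_le h (parent h' e)
  have b2 := offset_add_len_le h' e
  refine (parent_eq (h.trans h') (u := offset h (parent h' e) + (offset h' e + G''.graph.len e / 2))
    ⟨by linarith, by linarith⟩ m ?_).1.symm
  rw [edge_eq h' e (Ioo_subset_Icc_self m), edge_eq h _ ⟨by linarith, by linarith⟩]

theorem toHarmonicForms_injective (G : Compatible G₀) :
    Function.Injective (toHarmonicForms G₀ G) := by
  classical
  have : DirectedSystem (fun G : Compatible G₀ => G.1.graph.harmonicForms)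
      (fun _ _ h => pushforward h) :=
    { map_self := fun G ω => by
        refine Subtype.ext (funext fun e => congrArg ω.1 ?_)
        have l := G.1.graph.len_pos e
        have m : G.1.graph.len e / 2 ∈ Ioo 0 (G.1.graph.len e) := ⟨by linarith, by linarith⟩
        exact (parent_eq (le_refl G.1) m m rfl).1
      map_map := fun _ _ _ h h' ω =>
        Subtype.ext (funext fun e => congrArg ω.1 (parent_trans h h' e)) }
  rw [injective_iff_map_eq_zero]
  intro ω hω
  obtain ⟨G', h, h0⟩ := Module.DirectLimit.of.zero_exact hω
  exact (injective_iff_map_eq_zero _).1 (pushforward_injective h) _ h0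

/-- A class represented on another model can be pushed to a common refinement, and from there it
descends to `G`. -/
theorem toHarmonicForms_surjective (G : Compatible G₀) :
    Function.Surjective (toHarmonicForms G₀ G) := by
  classical
  intro x
  have : Nonempty (Compatible G₀) := ⟨G⟩
  induction x using Module.DirectLimit.induction_on with
  | ih G₁ ω =>
    obtain ⟨H, h, h₁, hH⟩ := exists_common_refinement G G₁
    obtain ⟨η, hη⟩ := pushforward_surjective h (pushforward h₁ ω)
    refine ⟨η, ?_⟩
    rw [← toHarmonicForms_pushforward (G' := refined hH) h, hη,
      toHarmonicForms_pushforward (G' := refined hH) h₁]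
    rfl

/-- Integration functionals can be computed on refinements. -/
theorem IsIntegral.refine {G G' : Compatible G₀} {α : G.1.graph.E → ℤ}
    {φ : Module.Dual ℝ (HarmonicForms G₀)} (hφ : IsIntegral G₀ G α φ) (h : G.1 ≤ G'.1) :
    IsIntegral G₀ G' (α ∘ parent h) φ := by
  intro ω'
  obtain ⟨ω, rfl⟩ := pushforward_surjective h ω'
  rw [toHarmonicForms_pushforward, integral_comp_parent, hφ]

theorem IsIntegral.of_refine {G G' : Compatible G₀} {α : G.1.graph.E → ℤ}
    {φ : Module.Dual ℝ (HarmonicForms G₀)} (h : G.1 ≤ G'.1)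
    (hφ : IsIntegral G₀ G' (α ∘ parent h) φ) : IsIntegral G₀ G α φ := by
  intro ω
  rw [← toHarmonicForms_pushforward h, hφ, integral_comp_parent]

theorem IsIntegral.add {G : Compatible G₀} {α β : G.1.graph.E → ℤ}
    {φ ψ : Module.Dual ℝ (HarmonicForms G₀)} (hφ : IsIntegral G₀ G α φ)
    (hψ : IsIntegral G₀ G β ψ) : IsIntegral G₀ G (α + β) (φ + ψ) := fun ω => by
  rw [LinearMap.add_apply, hφ, hψ, map_add, LinearMap.add_apply]

/-- The integral on `Ω(G)` is transported along the bijection `Ω(G) → Ω(Γ)`. -/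
theorem exists_isIntegral (G : Compatible G₀) (α : G.1.graph.E → ℤ) :
    ∃ φ, IsIntegral G₀ G α φ := by
  let g := LinearEquiv.ofBijective (toHarmonicForms G₀ G)
    ⟨toHarmonicForms_injective G, toHarmonicForms_surjective G⟩
  refine ⟨(G.1.graph.integral α).comp g.symm.toLinearMap, fun ω => ?_⟩
  exact congrArg (G.1.graph.integral α) (g.symm_apply_apply ω)

end Model

/-! ### Germs of rays at a point and independence of slopes. -/

section Rays

variable {Γ : Type*} [MetricSpace Γ] {ι ι' : Type*}

/-- The germs of the paths `r k` at `p` describe a neighbourhood of `p`. -/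
structure IsRaySystem (p : Γ) (r : ι → ℝ → Γ) (ε : ℝ) : Prop where
  pos : 0 < ε
  zero : ∀ k, r k 0 = p
  dist_eq : ∀ k, ∀ s ∈ Ico 0 ε, ∀ t ∈ Ico 0 ε, dist (r k s) (r k t) = |s - t|
  ne : ∀ k l, k ≠ l → ∀ t ∈ Ioo 0 ε, r k t ≠ r l t
  -- The point is inserted so that the condition also makes sense for a system without rays.
  mem_nhds : insert p (⋃ k, r k '' Ico 0 ε) ∈ 𝓝 p

theorem StarChart.isRaySystem {p : Γ} (σ : StarChart p) : IsRaySystem p σ.ray σ.radius where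
  pos := σ.radius_pos
  zero := σ.ray_zero
  dist_eq := σ.dist_same
  ne k l hkl t ht h := by
    have := σ.dist_ne k l hkl t ⟨ht.1.le, ht.2⟩ t ⟨ht.1.le, ht.2⟩
    rw [h, dist_self] at this
    linarith [ht.1]
  mem_nhds := mem_of_superset σ.mem_nhds (subset_insert _ _)

namespace IsRaySystem

variable {p : Γ} {r : ι → ℝ → Γ} {r' : ι' → ℝ → Γ} {ε ε' : ℝ}

theorem dist_self_eq (h : IsRaySystem p r ε) (k : ι) {t : ℝ} (ht : t ∈ Ico 0 ε) :
    dist (r k t) p = t := by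
  rw [← h.zero k, h.dist_eq k t ht 0 ⟨le_refl _, h.pos⟩, sub_zero, abs_of_nonneg ht.1]

/-- Each ray of one system at `p` initially agrees with a ray of any other system at `p`. -/
theorem exists_eventuallyEq [Finite ι'] (h : IsRaySystem p r ε) (h' : IsRaySystem p r' ε')
    (k : ι) : ∃ l, ∀ᶠ t in 𝓝[>] (0 : ℝ), r k t = r' l t := by
  obtain ⟨η, hη, hball⟩ := Metric.mem_nhds_iff.1 h'.mem_nhds
  set δ := min η (min ε ε')
  have hδ : 0 < δ := lt_min hη (lt_min h.pos h'.pos)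
  have hδη : δ ≤ η := min_le_left _ _
  have hδε : δ ≤ ε := (min_le_right _ _).trans (min_le_left _ _)
  have hδε' : δ ≤ ε' := (min_le_right _ _).trans (min_le_right _ _)
  -- Both systems are parametrized by the distance to `p`, so a common point has the same parameter
  -- on both rays.
  have hex : ∀ t : Ioo 0 δ, ∃ l, r k t = r' l t := by
    rintro ⟨t, ht⟩
    have hd := h.dist_self_eq k (t := t) ⟨ht.1.le, ht.2.trans_le hδε⟩
    have hmem : r k t ∈ Metric.ball p η := by
      rw [Metric.mem_ball, hd]
      exact ht.2.trans_le hδη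
    rcases hball hmem with hp | hu
    · rw [hp, dist_self] at hd
      exact absurd hd ht.1.ne
    · obtain ⟨l, s, hs, hls⟩ := mem_iUnion.1 hu
      refine ⟨l, ?_⟩
      have hd' := h'.dist_self_eq l hs
      rw [hls, hd] at hd'
      change r k t = r' l t
      rw [← hls, hd']
  -- The agreement sets are closed, pairwise disjoint, finite in number and cover a connected
  -- interval; the one that contains `δ / 2` is therefore everything.
  let C : ι' → Set (Ioo 0 δ) := fun l => {t | r k t = r' l t}
  have hclosed : ∀ l, IsClosed (C l) := fun l => isClosed_eq (by
    refine (Isometry.of_dist_eq fun s t => ?_).continuous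
    rw [h.dist_eq k s ⟨s.2.1.le, s.2.2.trans_le hδε⟩ t ⟨t.2.1.le, t.2.2.trans_le hδε⟩]
    rfl) (by
    refine (Isometry.of_dist_eq fun s t => ?_).continuous
    rw [h'.dist_eq l s ⟨s.2.1.le, s.2.2.trans_le hδε'⟩ t ⟨t.2.1.le, t.2.2.trans_le hδε'⟩]
    rfl)
  have hδ2 : δ / 2 ∈ Ioo 0 δ := ⟨by linarith, by linarith⟩
  obtain ⟨l, hl⟩ := hex ⟨δ / 2, hδ2⟩
  have hcompl : (C l)ᶜ = ⋃ j : {j // j ≠ l}, C j := by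
    ext t
    simp only [mem_compl_iff, mem_iUnion, C, mem_ofPred_eq]
    constructor
    · intro ht
      obtain ⟨j, hj⟩ := hex t
      exact ⟨⟨j, fun hjl => ht (hjl ▸ hj)⟩, hj⟩
    · rintro ⟨⟨j, hjl⟩, hj⟩ ht
      exact h'.ne j l hjl t ⟨t.2.1, t.2.2.trans_le hδε'⟩ (hj.symm.trans ht)
  have hopen : IsOpen (C l) := by
    rw [← isClosed_compl_iff, hcompl]
    exact isClosed_iUnion_of_finite fun j => hclosed j
  have : PreconnectedSpace (Ioo 0 δ) := isPreconnected_iff_preconnectedSpace.1 isPreconnected_Ioo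
  have huniv := IsClopen.eq_univ ⟨hclosed l, hopen⟩ ⟨_, hl⟩
  refine ⟨l, ?_⟩
  filter_upwards [Ioo_mem_nhdsGT hδ] with t ht
  exact (huniv.symm ▸ mem_univ _ : (⟨t, ht⟩ : Ioo 0 δ) ∈ C l)

theorem eq_of_eventuallyEq (h : IsRaySystem p r ε) {k l : ι}
    (hkl : ∀ᶠ t in 𝓝[>] (0 : ℝ), r k t = r l t) : k = l := by
  by_contra hne
  obtain ⟨t, h1, h2⟩ := (hkl.and (Ioo_mem_nhdsGT h.pos)).exists
  exact h.ne k l hne t h2 h1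

/-- The matchings in the two directions are inverse to each other because distinct rays of one
system never have the same germ. -/
theorem exists_equiv [Finite ι] [Finite ι'] (h : IsRaySystem p r ε) (h' : IsRaySystem p r' ε') :
    ∃ b : ι ≃ ι', ∀ k, ∀ᶠ t in 𝓝[>] (0 : ℝ), r k t = r' (b k) t := by
  choose b hb using h.exists_eventuallyEq h'
  choose c hc using h'.exists_eventuallyEq h
  refine ⟨⟨b, c, fun k => ?_, fun l => ?_⟩, hb⟩
  · refine h.eq_of_eventuallyEq ?_
    filter_upwards [hb k, hc (b k)] with t h1 h2
    rw [h1, h2]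
  · refine h'.eq_of_eventuallyEq ?_
    filter_upwards [hc l, hb (c l)] with t h1 h2
    rw [h1, h2]

/-- The outgoing slopes of a function can be computed with any system of rays. -/
theorem exists_slopes [Fintype ι] [Fintype ι'] (h : IsRaySystem p r ε)
    (h' : IsRaySystem p r' ε') {f : Γ → ℝ} {d : ℤ}
    (hm : ∃ m : ι → ℤ, (∀ k, ∀ᶠ t in 𝓝[>] (0 : ℝ), f (r k t) = f p + m k * t) ∧ d = -∑ k, m k) :
    ∃ m : ι' → ℤ, (∀ k, ∀ᶠ t in 𝓝[>] (0 : ℝ), f (r' k t) = f p + m k * t) ∧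
      d = -∑ k, m k := by
  obtain ⟨m, hm, hd⟩ := hm
  obtain ⟨b, hb⟩ := h'.exists_equiv h
  refine ⟨m ∘ b, fun k => ?_, ?_⟩
  · filter_upwards [hb k, hm (b k)] with t h1 h2
    rw [h1, h2, Function.comp]
  · rw [hd]
    exact congrArg Neg.neg (Equiv.sum_comp b m).symm

end IsRaySystem

end Rays

/-! ### Rays at vertices and Laplacians of edgewise affine functions. -/

namespace Model

variable {Γ : Type*} [MetricSpace Γ] {G G' : Model Γ}

theorem continuousOn_edge (G : Model Γ) (e : G.graph.E) :
    ContinuousOn (G.edge e) (Icc 0 (G.graph.len e)) := by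
  obtain ⟨ε, hε, h⟩ := G.locally_isometric e
  rw [Metric.continuousOn_iff]
  intro s hs η hη
  refine ⟨min ε η, lt_min hε hη, fun t ht hst => ?_⟩
  rw [Real.dist_eq] at hst
  rw [h t ht s hs (hst.trans_le (min_le_left _ _))]
  exact hst.trans_le (min_le_right _ _)

/-- The directions at a vertex: the edges that leave it and the edges that arrive at it. -/
abbrev Direction (G : Model Γ) (v : G.graph.V) : Type :=
  {e // G.graph.tail e = v} ⊕ {e // G.graph.head e = v}

/-- The paths that leave a vertex in the various directions. -/
def vertexRay (G : Model Γ) (v : G.graph.V) : G.Direction v → ℝ → Γ :=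
  Sum.elim (fun e t => G.edge e.1 t) (fun e t => G.edge e.1 (G.graph.len e.1 - t))

theorem exists_isRaySystem (G : Model Γ) (v : G.graph.V) :
    ∃ ε, IsRaySystem (G.vertex v) (G.vertexRay v) ε := by
  classical
  choose η hη hiso using G.locally_isometric
  -- The bound by half the length keeps the two ends of a loop from meeting.
  have hev : ∀ᶠ ε in 𝓝[>] (0 : ℝ), ∀ e, ε < min (η e) (G.graph.len e / 2) :=
    eventually_all.2 fun e => by
      filter_upwards [Ioo_mem_nhdsGT (lt_min (hη e) (half_pos (G.graph.len_pos e)))] with t ht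
        using ht.2
  obtain ⟨ε, hεe, hε⟩ := (hev.and self_mem_nhdsWithin).exists
  have hε0 : 0 < ε := hε
  have h1 : ∀ e, ε < η e := fun e => (hεe e).trans_le (min_le_left _ _)
  have h2 : ∀ e, ε < G.graph.len e / 2 := fun e => (hεe e).trans_le (min_le_right _ _)
  refine ⟨ε, hε, ?_, ?_, ?_, ?_⟩
  · rintro (⟨e, rfl⟩ | ⟨e, rfl⟩)
    · exact G.edge_zero e
    · simpa [vertexRay] using G.edge_len e
  · rintro (⟨e, he⟩ | ⟨e, he⟩) s hs t ht
    · exact hiso e s ⟨hs.1, by linarith [h2 e, hs.2, hs.1]⟩ t ⟨ht.1, by linarith [h2 e, ht.2, ht.1]⟩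
        (abs_lt.2 ⟨by linarith [h1 e, hs.1, ht.2], by linarith [h1 e, hs.2, ht.1]⟩)
    · have := hiso e (G.graph.len e - s) ⟨by linarith [h2 e, hs.2, hs.1], by linarith [hs.1]⟩
        (G.graph.len e - t) ⟨by linarith [h2 e, ht.2, ht.1], by linarith [ht.1]⟩
        (abs_lt.2 ⟨by linarith [h1 e, hs.2, ht.1], by linarith [h1 e, hs.1, ht.2]⟩)
      refine this.trans ?_
      rw [sub_sub_sub_cancel_left, abs_sub_comm]
  · have i1 : ∀ e, ∀ t ∈ Ioo 0 ε, t ∈ Ioo 0 (G.graph.len e) := fun e t ht =>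
      ⟨ht.1, by linarith [ht.1, ht.2, h2 e]⟩
    have i2 : ∀ e, ∀ t ∈ Ioo 0 ε, G.graph.len e - t ∈ Ioo 0 (G.graph.len e) := fun e t ht =>
      ⟨by linarith [ht.1, ht.2, h2 e], by linarith [ht.1]⟩
    rintro (⟨e, he⟩ | ⟨e, he⟩) (⟨e', he'⟩ | ⟨e', he'⟩) hne t ht h
    · obtain ⟨rfl, -⟩ := G.edge_injective _ _ _ (i1 _ t ht) _ (i1 _ t ht) h
      exact hne rfl
    · obtain ⟨rfl, h3⟩ := G.edge_injective _ _ _ (i1 _ t ht) _ (i2 _ t ht) h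
      linarith [h2 e, ht.2]
    · obtain ⟨rfl, h3⟩ := G.edge_injective _ _ _ (i2 _ t ht) _ (i1 _ t ht) h
      linarith [h2 e, ht.2]
    · obtain ⟨rfl, -⟩ := G.edge_injective _ _ _ (i2 _ t ht) _ (i2 _ t ht) h
      exact hne rfl
  -- Trimming the edges by `ε` at their ends at `v`, and adding the other vertices, gives a closed
  -- set `K` that misses `v`; its complement is covered by the rays.
  · let a : G.graph.E → ℝ := fun e => if G.graph.tail e = v then ε else 0
    let b : G.graph.E → ℝ := fun e => G.graph.len e - if G.graph.head e = v then ε else 0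
    have ha : ∀ e, 0 ≤ a e := fun e => by
      simp only [a]
      split_ifs <;> linarith
    have hb : ∀ e, b e ≤ G.graph.len e := fun e => by
      simp only [b]
      split_ifs <;> linarith
    let K : Set Γ := (⋃ e, G.edge e '' Icc (a e) (b e)) ∪ ⋃ w : {w // w ≠ v}, {G.vertex w}
    have hK : IsClosed K := by
      refine (isClosed_iUnion_of_finite fun e => ?_).union
        (isClosed_iUnion_of_finite fun w => isClosed_singleton)
      exact (isCompact_Icc.image_of_continuousOn
        ((G.continuousOn_edge e).mono (Icc_subset_Icc (ha e) (hb e)))).isClosed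
    have hv : G.vertex v ∉ K := by
      rintro (h | h)
      · obtain ⟨e, t, ht, het⟩ := mem_iUnion.1 h
        rcases ((ha e).trans ht.1).lt_or_eq with h0 | h0
        · rcases (ht.2.trans (hb e)).lt_or_eq with h3 | h3
          · exact G.edge_ne_vertex e t ⟨h0, h3⟩ v het
          · rw [h3, G.edge_len] at het
            have := ht.2
            simp only [b, G.vertex_injective het, if_true] at this
            linarith
        · rw [← h0, G.edge_zero] at het
          have := ht.1
          simp only [a, G.vertex_injective het, if_true] at this
          linarith
      · obtain ⟨w, hw⟩ := mem_iUnion.1 h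
        exact w.2 (G.vertex_injective hw).symm
    refine mem_of_superset (hK.isOpen_compl.mem_nhds hv) fun x hx => ?_
    rcases G.cover x with ⟨w, rfl⟩ | ⟨e, t, ht, rfl⟩
    · refine Or.inl ?_
      by_contra hw
      exact hx (Or.inr (mem_iUnion.2 ⟨⟨w, fun h => hw (by rw [h])⟩, rfl⟩))
    · refine Or.inr (mem_iUnion.2 ?_)
      have hab : t < a e ∨ b e < t := by
        by_contra! hab
        exact hx (Or.inl (mem_iUnion.2 ⟨e, t, hab, rfl⟩))
      rcases hab with h3 | h3
      · by_cases he : G.graph.tail e = v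
        · simp only [a, if_pos he] at h3
          exact ⟨Sum.inl ⟨e, he⟩, t, ⟨ht.1.le, h3⟩, rfl⟩
        · simp only [a, if_neg he] at h3
          exact absurd ht.1 h3.not_gt
      · by_cases he : G.graph.head e = v
        · simp only [b, if_pos he] at h3
          exact ⟨Sum.inr ⟨e, he⟩, G.graph.len e - t, ⟨by linarith [ht.2], by linarith⟩,
            by simp [vertexRay]⟩
        · simp only [b, if_neg he, sub_zero] at h3
          exact absurd ht.2 h3.not_gt

-- The slope `γ e` in the direction of `e` is outgoing at the tail and changes sign at the head.
open scoped Classical in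
theorem sum_direction (G : Model Γ) (γ : G.graph.E → ℤ) (v : G.graph.V) {m : G.Direction v → ℤ}
    (h1 : ∀ e, m (Sum.inl e) = γ e) (h2 : ∀ e, m (Sum.inr e) = -γ e) :
    G.graph.dStar ℤ γ v = -∑ k, m k := by
  simp only [Fintype.sum_sum_type, h1, h2, Finset.sum_neg_distrib]
  have e1 : ∑ e : {e // G.graph.tail e = v}, γ e = ∑ e with G.graph.tail e = v, γ e :=
    (Finset.sum_subtype (Finset.univ.filter fun e => G.graph.tail e = v) (by simp) γ).symm
  have e2 : ∑ e : {e // G.graph.head e = v}, γ e = ∑ e with G.graph.head e = v, γ e :=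
    (Finset.sum_subtype (Finset.univ.filter fun e => G.graph.head e = v) (by simp) γ).symm
  rw [neg_add, neg_neg, ← sub_eq_neg_add]
  rw [e1, e2]
  rfl

/-- A function that is affine on the edges of a model with integer slopes `α` has Laplacian
`d*α`. -/
theorem hasLaplacian_boundary (G : Model Γ) (α : G.graph.E → ℤ) {F : Γ → ℝ}
    (hF : ∀ e, ∀ t ∈ Icc 0 (G.graph.len e),
      F (G.edge e t) = F (G.vertex (G.graph.tail e)) + α e * t) :
    HasLaplacian F (G.boundary α) := by
  classical
  intro p σ
  -- Making `p` a vertex avoids a separate treatment of interior points.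
  obtain ⟨G', h, hp⟩ := G.exists_refinement {p} (finite_singleton p)
  obtain ⟨v, rfl⟩ := hp p rfl
  have hF' : ∀ e, ∀ t ∈ Icc 0 (G'.graph.len e),
      F (G'.edge e t) = F (G'.vertex (G'.graph.tail e)) + (α ∘ parent h) e * t := by
    intro e t ht
    have h0 := offset_nonneg h e
    have h1 := offset_add_len_le h e
    have l := G'.graph.len_pos e
    rw [edge_eq h e ht, ← edge_offset h, hF _ _ ⟨by linarith [ht.1], by linarith [ht.2]⟩,
      hF _ _ ⟨h0, by linarith⟩, Function.comp]
    ring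
  obtain ⟨ε, hr⟩ := G'.exists_isRaySystem v
  refine hr.exists_slopes σ.isRaySystem ?_
  rw [← boundary_comp_parent h, boundary_apply_vertex]
  refine ⟨Sum.elim (fun e => α (parent h e.1)) (fun e => -α (parent h e.1)), ?_, ?_⟩
  · rintro (⟨e, rfl⟩ | ⟨e, rfl⟩)
    · filter_upwards [Ioo_mem_nhdsGT (G'.graph.len_pos e)] with t ht
      exact hF' e t ⟨ht.1.le, ht.2.le⟩
    · filter_upwards [Ioo_mem_nhdsGT (G'.graph.len_pos e)] with t ht
      simp only [vertexRay, Sum.elim_inr]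
      rw [hF' e _ ⟨by linarith [ht.2], by linarith [ht.1]⟩, ← G'.edge_len e,
        hF' e _ ⟨(G'.graph.len_pos e).le, le_refl _⟩]
      push_cast [Function.comp]
      ring
  · exact sum_direction G' (α ∘ parent h) v (fun _ => rfl) fun _ => rfl

/-- The affine extension to `Γ` of a function on the vertices of a model. -/
theorem exists_affine_extension (G : Model Γ) (α : G.graph.E → ℤ) {f : G.graph.V → ℝ}
    (hf : ∀ e, f (G.graph.head e) - f (G.graph.tail e) = α e * G.graph.len e) :
    ∃ F : Γ → ℝ, ∀ e, ∀ t ∈ Icc 0 (G.graph.len e),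
      F (G.edge e t) = F (G.vertex (G.graph.tail e)) + α e * t := by
  have hex : ∀ p, ∃ y, (∀ v, G.vertex v = p → y = f v) ∧
      ∀ e, ∀ t ∈ Ioo 0 (G.graph.len e), G.edge e t = p → y = f (G.graph.tail e) + α e * t := by
    intro p
    rcases G.cover p with ⟨v, rfl⟩ | ⟨e, t, ht, rfl⟩
    · exact ⟨f v, fun w hw => by rw [G.vertex_injective hw],
        fun e t ht h => absurd h (G.edge_ne_vertex e t ht v)⟩
    · refine ⟨f (G.graph.tail e) + α e * t, fun w hw => absurd hw.symm (G.edge_ne_vertex e t ht w),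
        fun e' t' ht' h => ?_⟩
      obtain ⟨rfl, rfl⟩ := G.edge_injective _ _ _ ht' _ ht h
      rfl
  choose F hV hE using hex
  refine ⟨F, fun e t ht => ?_⟩
  rw [hV _ _ rfl]
  rcases ht.1.lt_or_eq with h0 | h0
  · rcases ht.2.lt_or_eq with h1 | h1
    · exact hE _ e t ⟨h0, h1⟩ rfl
    · rw [h1, G.edge_len, hV _ _ rfl]
      linarith [hf e]
  · rw [← h0, G.edge_zero, hV _ _ rfl]
    ring

end Model

/-! ### Locally affine functions on an interval. -/

section Affine

theorem affine_unique_nhdsGT {a b m n x : ℝ} (h : ∀ᶠ u in 𝓝[>] x, a + m * u = b + n * u) :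
    m = n ∧ a = b := by
  obtain ⟨u, hu, hxu⟩ := (h.and self_mem_nhdsWithin).exists
  obtain ⟨v, hv, hxv⟩ := (h.and (Ioo_mem_nhdsGT hxu)).exists
  have hmn : (m - n) * (u - v) = 0 := by linarith
  have hm : m = n := by
    rcases mul_eq_zero.1 hmn with h | h <;> linarith [hxv.2]
  subst hm
  exact ⟨rfl, by linarith⟩

theorem affine_unique_nhdsLT {a b m n x : ℝ} (h : ∀ᶠ u in 𝓝[<] x, a + m * u = b + n * u) :
    m = n ∧ a = b := by
  obtain ⟨u, hu, hxu⟩ := (h.and self_mem_nhdsWithin).exists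
  obtain ⟨v, hv, hxv⟩ := (h.and (Ioo_mem_nhdsLT hxu)).exists
  have hmn : (m - n) * (u - v) = 0 := by linarith
  have hm : m = n := by
    rcases mul_eq_zero.1 hmn with h | h <;> linarith [hxv.1]
  subst hm
  exact ⟨rfl, by linarith⟩

/-- A function on an interval that is locally affine is affine. -/
theorem affine_of_locally_affine {g : ℝ → ℝ} {l m n : ℝ} (hl : 0 < l)
    (hg : ∀ t ∈ Ioo 0 l, ∃ a : ℝ, ∀ᶠ u in 𝓝 t, g u = g t + a * (u - t))
    (h0 : ∀ᶠ u in 𝓝[>] 0, g u = g 0 + m * u)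
    (h1 : ∀ᶠ u in 𝓝[<] l, g u = g l + n * (u - l)) : n = m ∧ g l - g 0 = m * l := by
  -- `U` is where the affine expression from the left end persists; it is open and, within the
  -- interval, closed and nonempty.
  let U : Set ℝ := {t | ∀ᶠ u in 𝓝 t, g u = g 0 + m * u}
  have hU : IsOpen U := isOpen_setOfPred_eventually_nhds
  have hne : (Ioo 0 l ∩ U).Nonempty := by
    have h2 : ∀ᶠ t in 𝓝[>] (0 : ℝ), t ∈ U := by
      filter_upwards [eventually_eventually_nhdsWithin.2 h0, self_mem_nhdsWithin] with t ht ht0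
      rwa [isOpen_Ioi.nhdsWithin_eq ht0] at ht
    obtain ⟨t, h3, h4⟩ := (h2.and (Ioo_mem_nhdsGT hl)).exists
    exact ⟨t, h4, h3⟩
  have hsub : Ioo 0 l ⊆ U := by
    refine isPreconnected_Ioo.subset_of_closure_inter_subset hU hne ?_
    rintro t ⟨htU, ht⟩
    obtain ⟨a, ha⟩ := hg t ht
    -- Near a point of `U` close to `t` both affine expressions hold, so they coincide.
    obtain ⟨s, hs, hsU⟩ := mem_closure_iff_nhds.1 htU _ (eventually_eventually_nhds.2 ha)
    have hs' : ∀ᶠ u in 𝓝 s, g u = g t + a * (u - t) := hs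
    have hsU' : ∀ᶠ u in 𝓝 s, g u = g 0 + m * u := hsU
    obtain ⟨rfl, h3⟩ := affine_unique_nhdsGT (x := s) (a := g t - a * t) (b := g 0) (m := a)
      (n := m) <| nhdsWithin_le_nhds (by
        filter_upwards [hs', hsU'] with u h1 h2
        linarith)
    change ∀ᶠ u in 𝓝 t, g u = g 0 + a * u
    filter_upwards [ha] with u hu
    linarith
  obtain ⟨h3, h4⟩ := affine_unique_nhdsLT (x := l) (a := g l - n * l) (b := g 0) (m := n)
    (n := m) (by
      filter_upwards [h1, Ioo_mem_nhdsLT hl] with u hu hul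
      have : g u = g 0 + m * u := (show ∀ᶠ u in 𝓝 u, g u = g 0 + m * u from hsub hul).self_of_nhds
      linarith)
  subst h3
  exact ⟨rfl, by linarith⟩

end Affine

/-! ### Piecewise affine functions become edgewise affine on a refinement. -/

namespace Model

variable {Γ : Type*} [MetricSpace Γ] {G₀ G G' : Model Γ}

open scoped Classical in
theorem _root_.TropicalCurves.HasLaplacian.exists_slopes [IsTropicalCurve Γ] {f : Γ → ℝ}
    {D : Γ →₀ ℤ} (hf : HasLaplacian f D) (G : Model Γ) (v : G.graph.V) :
    ∃ m : G.Direction v → ℤ,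
      (∀ k, ∀ᶠ t in 𝓝[>] (0 : ℝ), f (G.vertexRay v k t) = f (G.vertex v) + m k * t) ∧
        D (G.vertex v) = -∑ k, m k := by
  obtain ⟨σ⟩ := IsTropicalCurve.exists_starChart (G.vertex v)
  obtain ⟨ε, hr⟩ := G.exists_isRaySystem v
  exact σ.isRaySystem.exists_slopes hr (hf _ σ)

theorem tendsto_sub_nhdsGT (s : ℝ) : Tendsto (fun u => u - s) (𝓝[>] s) (𝓝[>] 0) := by
  refine tendsto_nhdsWithin_iff.2 ⟨?_, ?_⟩
  · have : Tendsto (fun u : ℝ => u - s) (𝓝 s) (𝓝 (s - s)) :=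
      (continuous_id.sub continuous_const).tendsto s
    rw [sub_self] at this
    exact this.mono_left nhdsWithin_le_nhds
  · filter_upwards [self_mem_nhdsWithin] with u hu
    exact sub_pos.2 (mem_Ioi.1 hu)

theorem tendsto_sub_nhdsLT (s : ℝ) : Tendsto (fun u => s - u) (𝓝[<] s) (𝓝[>] 0) := by
  refine tendsto_nhdsWithin_iff.2 ⟨?_, ?_⟩
  · have : Tendsto (fun u : ℝ => s - u) (𝓝 s) (𝓝 (s - s)) :=
      (continuous_const.sub continuous_id).tendsto s
    rw [sub_self] at this
    exact this.mono_left nhdsWithin_le_nhds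
  · filter_upwards [self_mem_nhdsWithin] with u hu
    exact sub_pos.2 (mem_Iio.1 hu)

/-- Once the point is a vertex, the piece leaving it along `e` is one of its rays. -/
theorem _root_.TropicalCurves.HasLaplacian.affine_right [IsTropicalCurve Γ] {f : Γ → ℝ}
    {D : Γ →₀ ℤ} (hf : HasLaplacian f D) (G : Model Γ) (e : G.graph.E) {s : ℝ}
    (hs : s ∈ Ico 0 (G.graph.len e)) :
    ∃ m : ℤ, ∀ᶠ u in 𝓝[>] s, f (G.edge e u) = f (G.edge e s) + m * (u - s) := by
  obtain ⟨G', h, hp⟩ := G.exists_refinement {G.edge e s} (finite_singleton _)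
  obtain ⟨v, hv⟩ := hp _ rfl
  obtain ⟨e', rfl, rfl⟩ := exists_outgoing h hs hv.symm
  obtain ⟨m, hm, -⟩ := hf.exists_slopes G' (G'.graph.tail e')
  refine ⟨m (Sum.inl ⟨e', rfl⟩), ?_⟩
  filter_upwards [(tendsto_sub_nhdsGT _).eventually (hm (Sum.inl ⟨e', rfl⟩)),
    (tendsto_sub_nhdsGT _).eventually (Ioo_mem_nhdsGT (G'.graph.len_pos e'))] with u hu hul
  rw [edge_offset, ← hu, vertexRay, Sum.elim_inl, edge_eq h e' (Ioo_subset_Icc_self hul),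
    add_sub_cancel]

theorem _root_.TropicalCurves.HasLaplacian.affine_left [IsTropicalCurve Γ] {f : Γ → ℝ}
    {D : Γ →₀ ℤ} (hf : HasLaplacian f D) (G : Model Γ) (e : G.graph.E) {s : ℝ}
    (hs : s ∈ Ioc 0 (G.graph.len e)) :
    ∃ m : ℤ, ∀ᶠ u in 𝓝[<] s, f (G.edge e u) = f (G.edge e s) + m * (u - s) := by
  obtain ⟨G', h, hp⟩ := G.exists_refinement {G.edge e s} (finite_singleton _)
  obtain ⟨v, hv⟩ := hp _ rfl
  obtain ⟨e', rfl, rfl⟩ := exists_incoming h hs hv.symm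
  obtain ⟨m, hm, -⟩ := hf.exists_slopes G' (G'.graph.head e')
  refine ⟨-m (Sum.inr ⟨e', rfl⟩), ?_⟩
  filter_upwards [(tendsto_sub_nhdsLT _).eventually (hm (Sum.inr ⟨e', rfl⟩)),
    (tendsto_sub_nhdsLT _).eventually (Ioo_mem_nhdsGT (G'.graph.len_pos e'))] with u hu hul
  rw [vertexRay, Sum.elim_inr, edge_eq h e' ⟨by linarith [hul.2], by linarith [hul.1]⟩] at hu
  rw [edge_offset_add_len]
  convert hu using 2
  · congr 1
    ring
  · push_cast
    ring

/-- The positions in an edge at which a function is not locally affine with integer slope. -/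
def breakpoints (G : Model Γ) (f : Γ → ℝ) (e : G.graph.E) : Set ℝ :=
  {s | s ∈ Ioo 0 (G.graph.len e) ∧
    ¬ ∃ m : ℤ, ∀ᶠ u in 𝓝 s, f (G.edge e u) = f (G.edge e s) + m * (u - s)}

/-- Infinitely many breakpoints would accumulate in the compact edge; but on each side of the limit
the function is affine, so points close to it are not breakpoints. -/
theorem _root_.TropicalCurves.HasLaplacian.finite_breakpoints [IsTropicalCurve Γ] {f : Γ → ℝ}
    {D : Γ →₀ ℤ} (hf : HasLaplacian f D) (G : Model Γ) (e : G.graph.E) :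
    (G.breakpoints f e).Finite := by
  by_contra hinf
  obtain ⟨s, hs, hacc⟩ := Set.Infinite.exists_accPt_of_subset_isCompact hinf
    (isCompact_Icc (a := 0) (b := G.graph.len e)) fun t ht => ⟨ht.1.1.le, ht.1.2.le⟩
  rw [accPt_iff_frequently_nhdsNE] at hacc
  refine hacc ?_
  rw [← nhdsLT_sup_nhdsGT, eventually_sup]
  have good : ∀ {m : ℤ} {u : ℝ} {c : ℝ},
      (∀ᶠ w in 𝓝 u, f (G.edge e w) = c + m * (w - s)) → u ∉ G.breakpoints f e := by
    intro m u c h hu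
    refine hu.2 ⟨m, ?_⟩
    filter_upwards [h] with w hw
    rw [hw, h.self_of_nhds]
    ring
  constructor
  -- At an end of the edge there are no breakpoints on the outer side.
  · by_cases h0 : s = 0
    · filter_upwards [self_mem_nhdsWithin] with u hu hb
      exact absurd hb.1.1 (by rw [← h0]; exact (mem_Iio.1 hu).not_gt)
    · obtain ⟨m, hm⟩ := hf.affine_left G e ⟨lt_of_le_of_ne hs.1 (Ne.symm h0), hs.2⟩
      filter_upwards [eventually_eventually_nhdsWithin.2 hm, self_mem_nhdsWithin] with u hu hus
      rw [isOpen_Iio.nhdsWithin_eq hus] at hu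
      exact good hu
  · by_cases h0 : s = G.graph.len e
    · filter_upwards [self_mem_nhdsWithin] with u hu hb
      exact absurd hb.1.2 (by rw [← h0]; exact (mem_Ioi.1 hu).not_gt)
    · obtain ⟨m, hm⟩ := hf.affine_right G e ⟨hs.1, lt_of_le_of_ne hs.2 h0⟩
      filter_upwards [eventually_eventually_nhdsWithin.2 hm, self_mem_nhdsWithin] with u hu hus
      rw [isOpen_Ioi.nhdsWithin_eq hus] at hu
      exact good hu

/-- A piecewise affine function with integer slopes is affine on the edges of a refinement, and
its Laplacian is the boundary of its slopes. -/
theorem _root_.TropicalCurves.HasLaplacian.exists_refinement [IsTropicalCurve Γ] {f : Γ → ℝ}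
    {D : Γ →₀ ℤ} (hf : HasLaplacian f D) (G : Model Γ) :
    ∃ G', G ≤ G' ∧ ∃ γ : G'.graph.E → ℤ, (G'.boundary γ : Γ →₀ ℤ) = D ∧
      ∀ e, f (G'.vertex (G'.graph.head e)) - f (G'.vertex (G'.graph.tail e)) =
        γ e * G'.graph.len e := by
  classical
  -- Breakpoints become vertices so that `f` is locally affine inside edges, and so does the support
  -- of `D`, which then vanishes off the vertices like any boundary.
  obtain ⟨G', h, hS⟩ := G.exists_refinement
    ((⋃ e, G.edge e '' G.breakpoints f e) ∪ (D.support : Set Γ))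
    ((finite_iUnion fun e => (hf.finite_breakpoints G e).image _).union D.support.finite_toSet)
  have hbreak : ∀ e, ∀ t ∈ Ioo 0 (G'.graph.len e), ∃ m : ℝ, ∀ᶠ u in 𝓝 t,
      f (G'.edge e u) = f (G'.edge e t) + m * (u - t) := by
    intro e t ht
    have h0 := offset_nonneg h e
    have h1 := offset_add_len_le h e
    have hnot : offset h e + t ∉ G.breakpoints f (parent h e) := by
      intro hb
      obtain ⟨v, hv⟩ := hS (G'.edge e t)
        (Or.inl (mem_iUnion.2 ⟨parent h e, _, hb, (edge_eq h e (Ioo_subset_Icc_self ht)).symm⟩))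
      exact G'.edge_ne_vertex e t ht v hv.symm
    simp only [breakpoints, mem_ofPred_eq, not_and, not_not] at hnot
    obtain ⟨m, hm⟩ := hnot ⟨by linarith [ht.1], by linarith [ht.2]⟩
    refine ⟨m, ?_⟩
    have hc : Tendsto (fun u => offset h e + u) (𝓝 t) (𝓝 (offset h e + t)) :=
      (continuous_const.add continuous_id).tendsto t
    filter_upwards [hc.eventually hm, isOpen_Ioo.mem_nhds ht] with u hu hul
    rw [edge_eq h e (Ioo_subset_Icc_self hul), edge_eq h e (Ioo_subset_Icc_self ht), hu,
      add_sub_add_left_eq_sub]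
  choose m hm hD using hf.exists_slopes G'
  -- Affinity along the edge makes the outgoing slopes at its two ends opposite; the one at the tail
  -- serves as `γ e`.
  have slope : ∀ e, -(m _ (Sum.inr ⟨e, rfl⟩) : ℝ) = m _ (Sum.inl ⟨e, rfl⟩) ∧
      f (G'.edge e (G'.graph.len e)) - f (G'.edge e 0) =
        m _ (Sum.inl ⟨e, rfl⟩) * G'.graph.len e := by
    intro e
    refine affine_of_locally_affine (g := fun t => f (G'.edge e t)) (G'.graph.len_pos e)
      (hbreak e) ?_ ?_
    · filter_upwards [hm _ (Sum.inl ⟨e, rfl⟩)] with t ht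
      rw [G'.edge_zero]
      exact ht
    · filter_upwards [(tendsto_sub_nhdsLT _).eventually (hm _ (Sum.inr ⟨e, rfl⟩))] with t ht
      rw [vertexRay, Sum.elim_inr, sub_sub_cancel] at ht
      rw [ht, G'.edge_len]
      ring
  refine ⟨G', h, fun e => m _ (Sum.inl ⟨e, rfl⟩), ?_, fun e => ?_⟩
  · ext p
    by_cases hp : ∃ v, G'.vertex v = p
    · obtain ⟨v, rfl⟩ := hp
      rw [boundary_apply_vertex, hD]
      refine sum_direction G' _ v ?_ ?_
      · rintro ⟨e, rfl⟩
        rfl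
      · rintro ⟨e, rfl⟩
        exact neg_eq_iff_eq_neg.1 (by exact_mod_cast (slope e).1)
    · have hp' : D p = 0 := by
        by_contra hne
        exact hp (hS p (Or.inr (Finsupp.mem_support_iff.2 hne)))
      push Not at hp
      rw [boundary_apply_of_not_vertex _ _ hp, hp']
  · rw [← G'.edge_len, ← G'.edge_zero]
    exact (slope e).2

end Model

/-! ### Duality: chains with zero integral are exact. -/

namespace WeightedGraph

variable (G : WeightedGraph)

theorem mem_harmonicForms_iff (ω : G.E → ℝ) : ω ∈ G.harmonicForms ↔ G.dStar ℝ ω = 0 := by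
  refine ⟨fun h => funext fun v => sub_eq_zero.2 (h v), fun h v => sub_eq_zero.1 (congrFun h v)⟩

-- Summation by parts: `d*` is adjoint to the difference operator.
open scoped Classical in
theorem sum_mul_dStar (f : G.V → ℝ) (ω : G.E → ℝ) :
    ∑ v, f v * G.dStar ℝ ω v = ∑ e, (f (G.head e) - f (G.tail e)) * ω e := by
  have h1 := Finset.sum_fiberwise Finset.univ G.head fun e => f (G.head e) * ω e
  have h2 := Finset.sum_fiberwise Finset.univ G.tail fun e => f (G.tail e) * ω e
  simp only [sub_mul, Finset.sum_sub_distrib]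
  rw [← h1, ← h2, ← Finset.sum_sub_distrib]
  refine Finset.sum_congr rfl fun v _ => ?_
  have e1 : ∑ e with G.head e = v, f (G.head e) * ω e = f v * ∑ e with G.head e = v, ω e := by
    rw [Finset.mul_sum]
    exact Finset.sum_congr rfl fun e he => by rw [(Finset.mem_filter.1 he).2]
  have e2 : ∑ e with G.tail e = v, f (G.tail e) * ω e = f v * ∑ e with G.tail e = v, ω e := by
    rw [Finset.mul_sum]
    exact Finset.sum_congr rfl fun e he => by rw [(Finset.mem_filter.1 he).2]
  rw [e1, e2, ← mul_sub]
  rfl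

/-- The integral of a chain vanishes on harmonic forms if the chain is the derivative of a
function on the vertices. -/
theorem integral_eq_zero_of_exact {α : G.E → ℤ} {f : G.V → ℝ}
    (hf : ∀ e, f (G.head e) - f (G.tail e) = α e * G.len e) : G.integral α = 0 := by
  ext ω
  have h := G.sum_mul_dStar f ω.1
  rw [(G.mem_harmonicForms_iff _).1 ω.2] at h
  simp only [Pi.zero_apply, mul_zero, Finset.sum_const_zero, hf] at h
  rw [LinearMap.zero_apply, h]
  exact Finset.sum_congr rfl fun e _ => by ring

/-- A functional that vanishes on the kernel of `d*` factors through `d*`, because the range of a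
transpose is the annihilator of the kernel. The values of the factor on basis vectors form the
potential `f`. -/
theorem exists_exact_of_integral_eq_zero {α : G.E → ℤ} (hα : G.integral α = 0) :
    ∃ f : G.V → ℝ, ∀ e, f (G.head e) - f (G.tail e) = α e * G.len e := by
  classical
  let A : Module.Dual ℝ (G.E → ℝ) :=
    ∑ e, ((α e : ℝ) * G.len e) • (LinearMap.proj e : (G.E → ℝ) →ₗ[ℝ] ℝ)
  have hA : ∀ ω, A ω = ∑ e, (α e : ℝ) * G.len e * ω e := fun ω => by simp [A]
  have hmem : A ∈ LinearMap.range (G.dStar ℝ).dualMap := by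
    rw [LinearMap.range_dualMap_eq_dualAnnihilator_ker, Submodule.mem_dualAnnihilator]
    intro ω hω
    have h := LinearMap.congr_fun hα ⟨ω, (G.mem_harmonicForms_iff ω).2 hω⟩
    rw [LinearMap.zero_apply] at h
    rw [hA, ← h]
    exact Finset.sum_congr rfl fun e _ => by ring
  obtain ⟨ψ, hψ⟩ := hmem
  refine ⟨fun v => ψ (Pi.single v 1), fun a => ?_⟩
  have h1 := G.sum_mul_dStar (fun v => ψ (Pi.single v 1)) (Pi.single a 1)
  have h2 : A (Pi.single a 1) = α a * G.len a := by
    rw [hA]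
    simp [Pi.single_apply]
  have h3 : ∑ e, (ψ (Pi.single (G.head e) 1) - ψ (Pi.single (G.tail e) 1)) *
      (Pi.single a 1 : G.E → ℝ) e = ψ (Pi.single (G.head a) 1) - ψ (Pi.single (G.tail a) 1) := by
    simp [Pi.single_apply]
  beta_reduce at h1
  rw [← h2, ← h3, ← h1, ← hψ, LinearMap.dualMap_apply,
    LinearMap.pi_apply_eq_sum_univ ψ (G.dStar ℝ (Pi.single a 1))]
  refine Finset.sum_congr rfl fun v _ => ?_
  rw [smul_eq_mul, mul_comm]
  congr 3
  ext w
  simp [Pi.single_apply, eq_comm]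

end WeightedGraph

/-! ### Realizing functionals and divisors by integral chains. -/

namespace Model

variable {Γ : Type*} [MetricSpace Γ] {G₀ G G' : Model Γ}

/-- Dividing `c` by a large integer brings it below `l` in absolute value. The quotient will be a
cut position and the integer a chain coefficient. -/
theorem exists_int_mul_eq (c : ℝ) {l : ℝ} (hl : 0 < l) : ∃ n : ℤ, ∃ s ∈ Ioo 0 l, n * s = c := by
  have pos : ∀ c : ℝ, 0 < c → ∃ n : ℤ, ∃ s ∈ Ioo 0 l, n * s = c := by
    intro c hc
    obtain ⟨N, hN⟩ := exists_nat_gt (c / l)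
    have hN0 : (0 : ℝ) < N := (div_pos hc hl).trans hN
    refine ⟨N, c / N, ⟨div_pos hc hN0, ?_⟩, ?_⟩
    · rwa [div_lt_iff₀ hN0, mul_comm, ← div_lt_iff₀ hl]
    · rw [Int.cast_natCast, mul_div_cancel₀ _ hN0.ne']
  rcases lt_trichotomy c 0 with hc | rfl | hc
  · obtain ⟨n, s, hs, h⟩ := pos (-c) (neg_pos.2 hc)
    exact ⟨-n, s, hs, by rw [Int.cast_neg, neg_mul, h, neg_neg]⟩
  · exact ⟨0, l / 2, ⟨by linarith, by linarith⟩, by simp⟩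
  · exact pos c hc

/-- Every functional on `Ω(Γ)` is the integration functional of an integral chain of a model. -/
theorem exists_chain_isIntegral (φ : Module.Dual ℝ (HarmonicForms G₀)) :
    ∃ (G : Compatible G₀) (α : G.1.graph.E → ℤ), IsIntegral G₀ G α φ := by
  classical
  -- Extending the functional to all `1`-forms of `G₀` gives it a coefficient on each single edge.
  obtain ⟨g, hg⟩ := LinearMap.exists_extend
    ((φ.comp (toHarmonicForms G₀ G₀.self) : Module.Dual ℝ G₀.graph.harmonicForms))
  have hφ : ∀ ω : G₀.graph.harmonicForms,
      φ (toHarmonicForms G₀ G₀.self ω) = ∑ e, ω.1 e * g (Pi.single e 1) := by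
    intro ω
    have h1 : φ (toHarmonicForms G₀ G₀.self ω) = g ω.1 := (LinearMap.congr_fun hg ω).symm
    rw [h1, LinearMap.pi_apply_eq_sum_univ g ω.1]
    refine Finset.sum_congr rfl fun e _ => ?_
    rw [smul_eq_mul]
    congr 2
    ext a
    simp [Pi.single_apply, eq_comm]
  choose n s hs hns using fun e => exists_int_mul_eq (g (Pi.single e 1)) (G₀.graph.len_pos e)
  obtain ⟨G, h, hv⟩ := G₀.exists_refinement (range fun e => G₀.edge e (s e)) (finite_range _)
  -- The pieces before the cut have total length `s e`, so the chain contributes `n e * s e` times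
  -- the value of the form on `e`.
  refine ⟨refined h, fun e' => if offset h e' + G.graph.len e' ≤ s (parent h e') then
    n (parent h e') else 0, fun ω' => ?_⟩
  obtain ⟨ω, rfl⟩ := pushforward_surjective h ω'
  rw [toHarmonicForms_pushforward (G := G₀.self) (G' := refined h) h, hφ, integral_apply,
    ← Finset.sum_fiberwise Finset.univ (parent h)]
  refine Finset.sum_congr rfl fun e _ => ?_
  rw [← hns, ← sum_len_le h (Ioo_subset_Icc_self (hs e)) (hv _ ⟨e, rfl⟩), ← Finset.filter_filter,
    Finset.sum_filter, Finset.mul_sum, Finset.mul_sum]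
  refine Finset.sum_congr rfl fun e' he' => ?_
  obtain rfl := (Finset.mem_filter.1 he').2
  simp only [pushforward, LinearMap.coe_mk, AddHom.coe_mk]
  split_ifs
  · ring
  · simp

open scoped Classical in
theorem boundary_single (G : Model Γ) (e : G.graph.E) :
    (G.boundary (Pi.single e 1) : Γ →₀ ℤ) =
      Finsupp.single (G.vertex (G.graph.head e)) 1 -
        Finsupp.single (G.vertex (G.graph.tail e)) 1 := by
  ext p
  by_cases hp : ∃ v, G.vertex v = p
  · obtain ⟨v, rfl⟩ := hp
    rw [boundary_apply_vertex, Finsupp.sub_apply]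
    simp [WeightedGraph.dStar, Finsupp.single_apply, G.vertex_injective.eq_iff]
  · push Not at hp
    rw [boundary_apply_of_not_vertex _ _ hp, Finsupp.sub_apply, Finsupp.single_eq_of_ne (hp _).symm,
      Finsupp.single_eq_of_ne (hp _).symm, sub_zero]

theorem exists_boundary_eq_single_sub_single (G : Model Γ) (v w : G.graph.V) :
    ∃ α, (G.boundary α : Γ →₀ ℤ) =
      Finsupp.single (G.vertex w) 1 - Finsupp.single (G.vertex v) 1 := by
  classical
  induction G.graph.connected v w with
  | refl => exact ⟨0, by rw [sub_self]; exact congrArg Subtype.val (map_zero G.boundaryHom)⟩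
  | tail _ hbc ih =>
    obtain ⟨α, hα⟩ := ih
    obtain ⟨e, ⟨rfl, rfl⟩ | ⟨rfl, rfl⟩⟩ := hbc
    · refine ⟨α + Pi.single e 1, ?_⟩
      rw [boundary_add, AddSubgroup.coe_add, hα, boundary_single]
      abel
    · refine ⟨α - Pi.single e 1, ?_⟩
      rw [boundary_sub, AddSubgroup.coe_sub, hα, boundary_single]
      abel

/-- Every divisor of degree zero is the boundary of an integral chain of a refinement. -/
theorem exists_boundary_eq (G₀ : Model Γ) (D : Div0 Γ) :
    ∃ (G : Compatible G₀) (α : G.1.graph.E → ℤ), G.1.boundary α = D := by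
  obtain ⟨D, hD⟩ := D
  obtain ⟨G, h, hv⟩ := G₀.exists_refinement D.support D.support.finite_toSet
  obtain ⟨v⟩ := G.graph.nonemptyV
  have hsum : ∑ p ∈ D.support, D p = 0 := by
    have : D.sum (fun _ n => n) = 0 := hD
    exact this
  have hmem : D ∈ ((Div0 Γ).subtype.comp G.boundaryHom).range := by
    -- Degree zero allows the base vertex to be subtracted at every point; each difference is the
    -- boundary of a path.
    have hD' : D = ∑ p ∈ D.support,
        D p • (Finsupp.single p 1 - Finsupp.single (G.vertex v) 1 : Γ →₀ ℤ) := by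
      simp only [smul_sub, Finset.sum_sub_distrib]
      rw [← Finset.sum_smul, hsum, zero_smul, sub_zero]
      simp only [Finsupp.smul_single, smul_eq_mul, mul_one]
      exact (Finsupp.sum_single D).symm
    rw [hD']
    refine sum_mem fun p hp => zsmul_mem ?_ _
    obtain ⟨w, rfl⟩ := hv p hp
    exact G.exists_boundary_eq_single_sub_single v w
  obtain ⟨α, hα⟩ := hmem
  exact ⟨refined h, α, Subtype.ext hα⟩

/-! ### Periods and principal divisors. -/

theorem isIntegral_zero_iff {G : Compatible G₀} {α : G.1.graph.E → ℤ} :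
    IsIntegral G₀ G α 0 ↔ G.1.graph.integral α = 0 :=
  ⟨fun h => LinearMap.ext fun ω => (h ω).symm, fun h ω => by rw [h]; rfl⟩

theorem IsIntegral.sub {G : Compatible G₀} {α β : G.1.graph.E → ℤ}
    {φ ψ : Module.Dual ℝ (HarmonicForms G₀)} (hφ : IsIntegral G₀ G α φ)
    (hψ : IsIntegral G₀ G β ψ) : IsIntegral G₀ G (α - β) (φ - ψ) := fun ω => by
  rw [LinearMap.sub_apply, hφ, hψ, map_sub, LinearMap.sub_apply]

/-- The integral of a chain is a period if and only if its boundary is principal. -/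
theorem IsIntegral.mem_cycleLattice_iff [IsTropicalCurve Γ] {G : Compatible G₀}
    {α : G.1.graph.E → ℤ} {φ : Module.Dual ℝ (HarmonicForms G₀)} (hφ : IsIntegral G₀ G α φ) :
    φ ∈ cycleLattice G₀ ↔ (G.1.boundary α : Γ →₀ ℤ) ∈ Prin Γ := by
  obtain ⟨G', h, h₀⟩ := G.2
  constructor
  · rintro ⟨β, hβ, hβφ⟩
    -- Both chains represent `φ`, so on a common model their difference has zero integral and gives
    -- the slopes of a function.
    have h1 := (hφ.refine (G' := refined h₀) h).sub (hβφ.refine (G' := refined h₀) h₀)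
    rw [sub_self, isIntegral_zero_iff] at h1
    obtain ⟨f, hf⟩ := G'.graph.exists_exact_of_integral_eq_zero h1
    obtain ⟨F, hF⟩ := G'.exists_affine_extension _ hf
    have h2 := G'.hasLaplacian_boundary _ hF
    rw [boundary_sub, boundary_comp_parent, boundary_comp_parent,
      (boundary_eq_zero_iff _ _).2 hβ, sub_zero] at h2
    exact ⟨F, h2⟩
  · rintro ⟨F, hF⟩
    obtain ⟨H, hH, γ, hγ, hγF⟩ := hF.exists_refinement G'
    have hγ0 : H.graph.integral γ = 0 :=
      H.graph.integral_eq_zero_of_exact (f := fun v => F (H.vertex v)) hγF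
    -- Subtracting the slopes of `F` leaves a cycle without changing the functional; the cycle
    -- descends to `G₀`.
    have hcyc : (α ∘ parent (h.trans hH)) - γ ∈ H.graph.integralCycles := by
      rw [← boundary_eq_zero_iff, boundary_sub, boundary_comp_parent, sub_eq_zero]
      exact Subtype.ext hγ.symm
    obtain ⟨β, hβ, hβγ⟩ := exists_integralCycle_comp_parent (h₀.trans hH) hcyc
    refine ⟨β, hβ, IsIntegral.of_refine (G' := refined (h₀.trans hH)) (h₀.trans hH) ?_⟩
    have h1 := (hφ.refine (G' := refined (h₀.trans hH)) (h.trans hH)).sub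
      (isIntegral_zero_iff.2 hγ0)
    rw [sub_zero] at h1
    exact hβγ ▸ h1

/-- Two chains can be replaced by chains of a common model. -/
theorem IsIntegral.exists_common {G₁ G₂ : Compatible G₀} {α : G₁.1.graph.E → ℤ}
    {β : G₂.1.graph.E → ℤ} {φ ψ : Module.Dual ℝ (HarmonicForms G₀)}
    (hφ : IsIntegral G₀ G₁ α φ) (hψ : IsIntegral G₀ G₂ β ψ) :
    ∃ (G : Compatible G₀) (α' β' : G.1.graph.E → ℤ),
      IsIntegral G₀ G α' φ ∧ IsIntegral G₀ G β' ψ ∧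
        G.1.boundary α' = G₁.1.boundary α ∧ G.1.boundary β' = G₂.1.boundary β := by
  obtain ⟨G, h₁, h₂, h⟩ := exists_common_refinement G₁ G₂
  exact ⟨refined h, _, _, hφ.refine h₁, hψ.refine h₂, boundary_comp_parent h₁ α,
    boundary_comp_parent h₂ β⟩

/-- The difference of the chains represents `0`, which is a period, so its boundary is principal. -/
theorem IsIntegral.boundary_class_eq [IsTropicalCurve Γ] {G₁ G₂ : Compatible G₀}
    {α : G₁.1.graph.E → ℤ} {β : G₂.1.graph.E → ℤ} {φ : Module.Dual ℝ (HarmonicForms G₀)}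
    (hα : IsIntegral G₀ G₁ α φ) (hβ : IsIntegral G₀ G₂ β φ) :
    (QuotientAddGroup.mk (G₁.1.boundary α) : Pic Γ) = QuotientAddGroup.mk (G₂.1.boundary β) := by
  obtain ⟨G, α', β', hα', hβ', h1, h2⟩ := hα.exists_common hβ
  have h3 := (hα'.sub hβ').mem_cycleLattice_iff.1 (by rw [sub_self]; exact zero_mem _)
  rw [← h1, ← h2, ← sub_eq_zero, ← QuotientAddGroup.mk_sub, QuotientAddGroup.eq_zero_iff,
    AddSubgroup.mem_addSubgroupOf, ← boundary_sub]
  exact h3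

/-! ### The Abel–Jacobi isomorphism. -/

/-- The homomorphism `Ω(Γ)* → Pic(Γ)` that sends `∫_α` to the class of `d*α`. -/
noncomputable def abelJacobiHom [IsTropicalCurve Γ] (G₀ : Model Γ) :
    Module.Dual ℝ (HarmonicForms G₀) →+ Pic Γ :=
  AddMonoidHom.mk'
    -- The representing chain is chosen; the class does not depend on it, which also gives
    -- additivity.
    (fun φ => QuotientAddGroup.mk ((exists_chain_isIntegral φ).choose.1.boundary
      (exists_chain_isIntegral φ).choose_spec.choose))
    fun φ ψ => by
      obtain ⟨G, α, β, hα, hβ, h1, h2⟩ :=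
        (exists_chain_isIntegral φ).choose_spec.choose_spec.exists_common
          (exists_chain_isIntegral ψ).choose_spec.choose_spec
      rw [← h1, ← h2, ← QuotientAddGroup.mk_add, ← boundary_add]
      exact (exists_chain_isIntegral (φ + ψ)).choose_spec.choose_spec.boundary_class_eq
        (hα.add hβ)

theorem abelJacobiHom_eq [IsTropicalCurve Γ] {G : Compatible G₀} {α : G.1.graph.E → ℤ}
    {φ : Module.Dual ℝ (HarmonicForms G₀)} (hφ : IsIntegral G₀ G α φ) :
    abelJacobiHom G₀ φ = QuotientAddGroup.mk (G.1.boundary α) :=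
  (exists_chain_isIntegral φ).choose_spec.choose_spec.boundary_class_eq hφ

theorem ker_abelJacobiHom [IsTropicalCurve Γ] (G₀ : Model Γ) :
    (abelJacobiHom G₀).ker = cycleLattice G₀ := by
  ext φ
  obtain ⟨G, α, hα⟩ := exists_chain_isIntegral φ
  rw [AddMonoidHom.mem_ker, abelJacobiHom_eq hα, hα.mem_cycleLattice_iff,
    QuotientAddGroup.eq_zero_iff, AddSubgroup.mem_addSubgroupOf]

theorem abelJacobiHom_surjective [IsTropicalCurve Γ] (G₀ : Model Γ) :
    Function.Surjective (abelJacobiHom G₀) := by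
  intro x
  obtain ⟨D, rfl⟩ := QuotientAddGroup.mk_surjective x
  obtain ⟨G, α, rfl⟩ := exists_boundary_eq G₀ D
  obtain ⟨φ, hφ⟩ := exists_isIntegral G α
  exact ⟨φ, abelJacobiHom_eq hφ⟩

/-- The isomorphism `J(Γ) → Pic(Γ)` induced by `∫_α ↦ d*α`. -/
noncomputable def abelJacobiEquiv [IsTropicalCurve Γ] (G₀ : Model Γ) :
    G₀.Jacobian ≃+ Pic Γ :=
  (QuotientAddGroup.quotientAddEquivOfEq (ker_abelJacobiHom G₀).symm).trans
    (QuotientAddGroup.quotientKerEquivOfSurjective _ (abelJacobiHom_surjective G₀))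

theorem abelJacobiEquiv_mk [IsTropicalCurve Γ] (φ : Module.Dual ℝ (HarmonicForms G₀)) :
    abelJacobiEquiv G₀ (QuotientAddGroup.mk φ) = abelJacobiHom G₀ φ := rfl

end Model

end TropicalCurves

theorem mainTheorem10 {Γ : Type*} [MetricSpace Γ] [TropicalCurves.IsTropicalCurve Γ]
    (G₀ : TropicalCurves.Model Γ) :
    ∃! h : G₀.Jacobian ≃+ TropicalCurves.Pic Γ,
      ∀ (G : G₀.Compatible) (α : G.1.graph.E → ℤ) (φ : Module.Dual ℝ G₀.HarmonicForms),
        G₀.IsIntegral G α φ →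
          h (QuotientAddGroup.mk φ) = QuotientAddGroup.mk (G.1.boundary α) := by
  refine ⟨TropicalCurves.Model.abelJacobiEquiv G₀, fun G α φ hφ => ?_, fun h hh => ?_⟩
  · rw [TropicalCurves.Model.abelJacobiEquiv_mk, TropicalCurves.Model.abelJacobiHom_eq hφ]
  -- Every class in the Jacobian comes from some `∫_α`, so the rule leaves no freedom.
  · ext x
    obtain ⟨φ, rfl⟩ := QuotientAddGroup.mk_surjective x
    obtain ⟨G, α, hα⟩ := TropicalCurves.Model.exists_chain_isIntegral φ
    rw [hh G α φ hα, TropicalCurves.Model.abelJacobiEquiv_mk,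
      TropicalCurves.Model.abelJacobiHom_eq hα]
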